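/- Consider the problem of minimizing $F(x,y)=f(x)+\theta(y)$ over $u=(x,y)\in\mathbb R^{n_1}\times\mathbb R^{n_2}$ subject to $Ex+Fy\le d$, $l\le Cx\le v$, $s\le Dy\le r$, where $f,\theta$ are $C^1$, the entries of $l,s$ lie in $\mathbb R\cup\{-\infty\}$, those of $v,r$ in $\mathbb R\cup\{+\infty\}$, and $l<v$, $s<r$ componentwise. Let $\mathcal F$ be the feasible set, $h(x,y)=Ex+Fy-d$, and $\|z\|_H^2=z^\top Hz$; $\|\cdot\|$ is the $\ell_2$ norm, and $0\le a\perp b\ge0$ denotes complementarity (a multiplier of an infinite bound is $0$). **Method (CFD-SQO$_1$-eq-free).** Parameters: $\rho,\sigma\in(0,1)$, $\tau_1,M,M_1>0$. Start at $u_0\in\mathcal F$ with symmetric positive definite $H_0^x,H_0^y$. At iteration $k$, write $h_k=h(x_k,y_k)$ and $H_k=\mathrm{diag}(H_k^x,H_k^y)$. 1. Solve $\min\{\nabla f(x_k)^\top(x-x_k)+\frac12\|x-x_k\|^2_{H_k^x}: Ex+Fy_k-d\le\frac12h_k,\ l\le Cx\le v\}$ and $\min\{\nabla\theta(y_k)^\top(y-y_k)+\frac12\|y-y_k\|^2_{H_k^y}: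 Ex_k+Fy-d\le\frac12h_k,\ s\le Dy\le r\}$, with solutions $\tilde x_{k+1},\tilde y_{k+1}$ and KKT multipliers $(\mu_k^x,\alpha_k^x,\gamma_k^x)$, $(\mu_k^y,\alpha_k^y,\gamma_k^y)$, and set $d_k=(\tilde x_{k+1}-x_k,\tilde y_{k+1}-y_k)$. 2. If $\min\{\|\mu_k^x\|,\|\mu_k^y\|\}\le M$ and $\|\mu_k^x-\mu_k^y\|\le M_1\|d_k\|^{\tau_1}$, keep $d_k$. Otherwise replace $(\tilde x_{k+1},\tilde y_{k+1})$ by the solution of the joint problem of minimizing the sum of the two quadratic objectives over $\mathcal F$ (with KKT multipliers), and set $d_k=(\tilde x_{k+1}-x_k,\tilde y_{k+1}-y_k)$. 3. Let $t_k$ be the largest $t\in\{1,\sigma,\sigma^2,\dots\}$ with $F(u_k+td_k)\le F(u_k)-\rho t\|d_k\|^2_{H_k}$, and set $u_{k+1}=u_k+t_kd_k$. Stop if $u_{k+1}=u_k$; otherwise choose symmetric positive definite $H_{k+1}^x,H_{k+1}^y$ and continue. For $u=(x,y)\in\mathcal F$ let $S_u,\,I^l_x,\,I^v_x,\,J^s_y,\,J^r_y$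 be the index sets of the constraints $Ex+Fy\le d$, $Cx\ge l$, $Cx\le v$, $Dy\ge s$, $Dy\le r$ that hold with equality, and $I_x=I^l_x\cup I^v_x$, $J_y=J^s_y\cup J^r_y$. For index sets $S,I,J$ let $\mathcal B(S,I,J)$ be the matrix with rows $(E_S\ F_S)$, $(C_I\ 0)$, $(0\ D_J)$. Let $S_k^+=S_{\tilde u_{k+1}}$ if the joint problem was used at iteration $k$, and otherwise $S_k^+=\{i:(E\tilde x_{k+1}+Fy_k-d-\frac12h_k)_i=0=(Ex_k+F\tilde y_{k+1}-d-\frac12h_k)_i\}$; put $\mathcal B_k=\mathcal B(S_k^+,I_{\tilde x_{k+1}},J_{\tilde y_{k+1}})$ and $P_k=\mathrm{Id}-\mathcal B_k^\top(\mathcal B_k\mathcal B_k^\top)^{-1}\mathcal B_k$. **Theorem.** Suppose that the method generates an infinite sequence $\{u_k\}$, that $\rho\in(0,\frac12)$ and $\tau_1\ge2$, and that the following hold. (a) There is $\eta>0$ with $H_k\succeq\eta\,\mathrm{Id}$ for all $k$, and $\{H_k\}_{k\in K}$ is bounded whenever $\{u_k\}_{k\in K}$ is bounded. (b) $f$ and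 $\theta$ are three times continuously differentiable in a neighborhood of $\mathcal F$. (c) $\{u_k\}$ is bounded and $u_*=(x_*,y_*)$ is an accumulation point of it such that $\mathcal B(S_{u_*},I_{x_*},J_{y_*})$ has full row rank, and such that for the (unique) KKT multiplier $(\mu_*,\alpha_*^x,\gamma_*^x,\alpha_*^y,\gamma_*^y)$ of the problem at $u_*$ one has $z^\top\nabla^2F(u_*)z>0$ for all $z\ne0$ with $\mathcal B(S_*^+,I_*^+,J_*^+)z=0$, where $S_*^+,I_*^+,J_*^+$ are the indices of the constraints active at $u_*$ with positive multiplier. (d) Either $\|(H_k-\nabla^2F(u_k))d_k\|=O(\|d_k\|^2)$; or $\|P_k(H_k-\nabla^2F(u_k))d_k\|=O(\|d_k\|^2)$ and strict complementarity holds at $u_*$ (all constraints active at $u_*$ have positive multipliers). Then $u_k\to u_*$ quadratically: $\lim_{k\to\infty}u_k=u_*$ and $\|u_{k+1}-u_*\|=O(\|u_k-u_*\|^2)$ as $k\to\infty$. -/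

import Mathlib

open Filter Topology Asymptotics

noncomputable section

namespace CFDSQO

/-- Real Euclidean space (with the `ℓ²` norm). -/
abbrev Vec (ι : Type) [Fintype ι] := EuclideanSpace ℝ ι

/-- The space of pairs `u = (x, y)`, with `‖u‖² = ‖x‖² + ‖y‖²`. -/
abbrev Pair (n₁ n₂ : ℕ) := EuclideanSpace ℝ (Fin n₁ ⊕ Fin n₂)

/-- The `x`-block of `u = (x, y)`. -/
def xp {n₁ n₂ : ℕ} (u : Pair n₁ n₂) : Vec (Fin n₁) := WithLp.toLp 2 (fun i => u (Sum.inl i))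

/-- The `y`-block of `u = (x, y)`. -/
def yp {n₁ n₂ : ℕ} (u : Pair n₁ n₂) : Vec (Fin n₂) := WithLp.toLp 2 (fun j => u (Sum.inr j))

/-- Two-block problem without equality constraints: minimize `f x + θ y` subject to
`E x + F y ≤ d`, `l ≤ C x ≤ v`, `s ≤ D y ≤ r`, with `f`, `θ` continuously differentiable.
The bounds may be infinite; `l < v` (and `s < r`) in `EReal` forces `l < ⊤` and `⊥ < v`. -/
structure Problem (n₁ n₂ m l₁ l₂ : ℕ) where
  f : Vec (Fin n₁) → ℝ
  θ : Vec (Fin n₂) → ℝ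
  E : Matrix (Fin m) (Fin n₁) ℝ
  F : Matrix (Fin m) (Fin n₂) ℝ
  d : Fin m → ℝ
  C : Matrix (Fin l₁) (Fin n₁) ℝ
  l : Fin l₁ → EReal
  v : Fin l₁ → EReal
  D : Matrix (Fin l₂) (Fin n₂) ℝ
  s : Fin l₂ → EReal
  r : Fin l₂ → EReal
  f_contDiff : ContDiff ℝ 1 f
  θ_contDiff : ContDiff ℝ 1 θ
  l_lt_v : ∀ i, l i < v i
  s_lt_r : ∀ j, s j < r j

/-- `lo ≤ G z ≤ hi`. -/
def InBox {q n : ℕ} (G : Matrix (Fin q) (Fin n) ℝ) (lo hi : Fin q → EReal)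
    (z : Vec (Fin n)) : Prop :=
  ∀ i, lo i ≤ ((G.mulVec z.ofLp i : ℝ) : EReal) ∧ ((G.mulVec z.ofLp i : ℝ) : EReal) ≤ hi i

/-- `0 ≤ μ ⊥ g ≥ 0` (for nonnegative vectors orthogonality is componentwise). -/
def Compl {q : ℕ} (μ g : Fin q → ℝ) : Prop :=
  ∀ i, 0 ≤ μ i ∧ 0 ≤ g i ∧ μ i * g i = 0

/-- `0 ≤ α ⊥ (G z - lo) ≥ 0` and `0 ≤ γ ⊥ (hi - G z) ≥ 0`; a multiplier of an infinite
bound is zero. -/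
def BoxCompl {q n : ℕ} (G : Matrix (Fin q) (Fin n) ℝ) (lo hi : Fin q → EReal)
    (z : Vec (Fin n)) (α γ : Fin q → ℝ) : Prop :=
  InBox G lo hi z ∧ ∀ i,
    (0 ≤ α i ∧ (α i = 0 ∨ lo i = ((G.mulVec z.ofLp i : ℝ) : EReal))) ∧
    (0 ≤ γ i ∧ (γ i = 0 ∨ hi i = ((G.mulVec z.ofLp i : ℝ) : EReal)))

open Classical in
/-- Indices `i` with `(G z)_i = b_i`. -/
def activeSet {q n : ℕ} (G : Matrix (Fin q) (Fin n) ℝ) (b : Fin q → EReal)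
    (z : Vec (Fin n)) : Finset (Fin q) :=
  Finset.univ.filter fun i => b i = ((G.mulVec z.ofLp i : ℝ) : EReal)

/-- The squared norm `zᵀ H z`. -/
def sqNorm {ι : Type} [Fintype ι] (H : Matrix ι ι ℝ) (z : Vec ι) : ℝ :=
  z.ofLp ⬝ᵥ H.mulVec z.ofLp

/-- The Hessian `∇²g(z)` as a linear operator. -/
def hess {ι : Type} [Fintype ι] (g : Vec ι → ℝ) (z : Vec ι) : Vec ι →L[ℝ] Vec ι :=
  fderiv ℝ (gradient g) z

/-- Multipliers of the two split subproblems. -/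
structure SplitMult (m l₁ l₂ : ℕ) where
  μx : Vec (Fin m)
  μy : Vec (Fin m)
  αx : Fin l₁ → ℝ
  γx : Fin l₁ → ℝ
  αy : Fin l₂ → ℝ
  γy : Fin l₂ → ℝ

/-- Multipliers of the joint subproblem, and of the problem itself. -/
structure Mult (m l₁ l₂ : ℕ) where
  μ : Vec (Fin m)
  αx : Fin l₁ → ℝ
  γx : Fin l₁ → ℝ
  αy : Fin l₂ → ℝ
  γy : Fin l₂ → ℝ

namespace Problem

variable {n₁ n₂ m l₁ l₂ : ℕ} (P : Problem n₁ n₂ m l₁ l₂)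

/-- The objective `f x + θ y`. -/
def obj (u : Pair n₁ n₂) : ℝ := P.f (xp u) + P.θ (yp u)

/-- `E x + F y - d`. -/
def h (x : Vec (Fin n₁)) (y : Vec (Fin n₂)) : Fin m → ℝ :=
  P.E.mulVec x.ofLp + P.F.mulVec y.ofLp - P.d

/-- The feasible set. -/
def feasible : Set (Pair n₁ n₂) :=
  {u | (∀ i, P.h (xp u) (yp u) i ≤ 0) ∧ InBox P.C P.l P.v (xp u) ∧ InBox P.D P.s P.r (yp u)}

/-- `f` and `θ` are three times continuously differentiable in a neighbourhood of the
feasible set. -/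
def CThreeNearFeasible : Prop :=
  ∃ V : Set (Pair n₁ n₂), IsOpen V ∧ P.feasible ⊆ V ∧
    ContDiffOn ℝ 3 (fun u => P.f (xp u)) V ∧ ContDiffOn ℝ 3 (fun u => P.θ (yp u)) V

/-- Lower and upper active indices of the constraint on `x`. -/
def activeX (x : Vec (Fin n₁)) : Finset (Fin l₁) := activeSet P.C P.l x ∪ activeSet P.C P.v x

/-- Lower and upper active indices of the constraint on `y`. -/
def activeY (y : Vec (Fin n₂)) : Finset (Fin l₂) := activeSet P.D P.s y ∪ activeSet P.D P.r y

open Classical in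
/-- Active indices of the coupling constraint. -/
def activeS (x : Vec (Fin n₁)) (y : Vec (Fin n₂)) : Finset (Fin m) :=
  Finset.univ.filter fun i => P.h x y i = 0

/-- The matrix with the rows `(E_S  F_S)`, `(C_I  0)`, `(0  D_J)`. -/
def rowMatrix (S : Finset (Fin m)) (I : Finset (Fin l₁)) (J : Finset (Fin l₂)) :
    Matrix (S ⊕ (I ⊕ J)) (Fin n₁ ⊕ Fin n₂) ℝ :=
  Matrix.fromRows
    (Matrix.fromCols (P.E.submatrix (fun i : S => i.1) id) (P.F.submatrix (fun i : S => i.1) id))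
    (Matrix.fromRows
      (Matrix.fromCols (P.C.submatrix (fun i : I => i.1) id) 0)
      (Matrix.fromCols 0 (P.D.submatrix (fun i : J => i.1) id)))

/-- The projection matrix `1 - Bᵀ (B Bᵀ)⁻¹ B` with `B = rowMatrix S I J`. -/
def projMatrix (S : Finset (Fin m)) (I : Finset (Fin l₁)) (J : Finset (Fin l₂)) :
    Matrix (Fin n₁ ⊕ Fin n₂) (Fin n₁ ⊕ Fin n₂) ℝ :=
  1 - (P.rowMatrix S I J).transpose *
    (P.rowMatrix S I J * (P.rowMatrix S I J).transpose)⁻¹ * P.rowMatrix S I J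

/-- Linear independence of the gradients of the constraints active at `u`. -/
def LICQ (u : Pair n₁ n₂) : Prop :=
  LinearIndependent ℝ
    (P.rowMatrix (P.activeS (xp u) (yp u)) (P.activeX (xp u)) (P.activeY (yp u))).row

/-- `u` together with the multipliers `Λ` is a primal-dual KKT solution. -/
def IsKKT (u : Pair n₁ n₂) (Λ : Mult m l₁ l₂) : Prop :=
  (gradient P.f (xp u)).ofLp + P.E.transpose.mulVec Λ.μ.ofLp
      + P.C.transpose.mulVec (Λ.γx - Λ.αx) = 0 ∧
  (gradient P.θ (yp u)).ofLp + P.F.transpose.mulVec Λ.μ.ofLp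
      + P.D.transpose.mulVec (Λ.γy - Λ.αy) = 0 ∧
  Compl Λ.μ.ofLp (-P.h (xp u) (yp u)) ∧
  BoxCompl P.C P.l P.v (xp u) Λ.αx Λ.γx ∧
  BoxCompl P.D P.s P.r (yp u) Λ.αy Λ.γy

open Classical in
/-- Active constraints with positive multipliers: coupling constraint. -/
def posS (u : Pair n₁ n₂) (Λ : Mult m l₁ l₂) : Finset (Fin m) :=
  (P.activeS (xp u) (yp u)).filter fun i => 0 < Λ.μ i

open Classical in
/-- Active constraints with positive multipliers: constraint on `x`. -/
def posX (u : Pair n₁ n₂) (Λ : Mult m l₁ l₂) : Finset (Fin l₁) :=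
  ((activeSet P.C P.l (xp u)).filter fun i => 0 < Λ.αx i) ∪
    ((activeSet P.C P.v (xp u)).filter fun i => 0 < Λ.γx i)

open Classical in
/-- Active constraints with positive multipliers: constraint on `y`. -/
def posY (u : Pair n₁ n₂) (Λ : Mult m l₁ l₂) : Finset (Fin l₂) :=
  ((activeSet P.D P.s (yp u)).filter fun j => 0 < Λ.αy j) ∪
    ((activeSet P.D P.r (yp u)).filter fun j => 0 < Λ.γy j)

/-- Strong second-order sufficient condition at `(u, Λ)`. -/
def SSOS (u : Pair n₁ n₂) (Λ : Mult m l₁ l₂) : Prop :=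
  ∀ z : Pair n₁ n₂, z ≠ 0 →
    (P.rowMatrix (P.posS u Λ) (P.posX u Λ) (P.posY u Λ)).mulVec z.ofLp = 0 →
    0 < inner ℝ z (hess P.obj u z)

/-- Strict complementarity at `(u, Λ)`. -/
def StrictCompl (u : Pair n₁ n₂) (Λ : Mult m l₁ l₂) : Prop :=
  (∀ i ∈ activeSet P.C P.l (xp u), 0 < Λ.αx i) ∧
  (∀ i ∈ activeSet P.C P.v (xp u), 0 < Λ.γx i) ∧
  (∀ j ∈ activeSet P.D P.s (yp u), 0 < Λ.αy j) ∧
  (∀ j ∈ activeSet P.D P.r (yp u), 0 < Λ.γy j) ∧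
  (∀ i ∈ P.activeS (xp u) (yp u), 0 < Λ.μ i)

/-! The quadratic subproblems at the iterate `u`, with contraction parameter `c`. -/

/-- Objective of the `x`-subproblem. -/
def qx (u : Pair n₁ n₂) (H : Matrix (Fin n₁) (Fin n₁) ℝ) (x : Vec (Fin n₁)) : ℝ :=
  inner ℝ (gradient P.f (xp u)) (x - xp u) + 1 / 2 * sqNorm H (x - xp u)

/-- Objective of the `y`-subproblem. -/
def qy (u : Pair n₁ n₂) (H : Matrix (Fin n₂) (Fin n₂) ℝ) (y : Vec (Fin n₂)) : ℝ :=
  inner ℝ (gradient P.θ (yp u)) (y - yp u) + 1 / 2 * sqNorm H (y - yp u)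

/-- Feasible set of the `x`-subproblem. -/
def splitFeasX (c : ℝ) (u : Pair n₁ n₂) : Set (Vec (Fin n₁)) :=
  {x | (∀ i, P.h x (yp u) i ≤ c / 2 * P.h (xp u) (yp u) i) ∧ InBox P.C P.l P.v x}

/-- Feasible set of the `y`-subproblem. -/
def splitFeasY (c : ℝ) (u : Pair n₁ n₂) : Set (Vec (Fin n₂)) :=
  {y | (∀ i, P.h (xp u) y i ≤ c / 2 * P.h (xp u) (yp u) i) ∧ InBox P.D P.s P.r y}

/-- The two blocks of `w` solve the two split subproblems at `u`, with multipliers `Λ`. -/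
def SolvesSplit (c : ℝ) (u : Pair n₁ n₂) (Hx : Matrix (Fin n₁) (Fin n₁) ℝ)
    (Hy : Matrix (Fin n₂) (Fin n₂) ℝ) (w : Pair n₁ n₂) (Λ : SplitMult m l₁ l₂) : Prop :=
  (xp w ∈ P.splitFeasX c u ∧ IsMinOn (P.qx u Hx) (P.splitFeasX c u) (xp w)) ∧
  (yp w ∈ P.splitFeasY c u ∧ IsMinOn (P.qy u Hy) (P.splitFeasY c u) (yp w)) ∧
  (gradient P.f (xp u)).ofLp + Hx.mulVec (xp w - xp u).ofLp + P.E.transpose.mulVec Λ.μx.ofLp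
      + P.C.transpose.mulVec (Λ.γx - Λ.αx) = 0 ∧
  Compl Λ.μx.ofLp ((c / 2) • P.h (xp u) (yp u) - P.h (xp w) (yp u)) ∧
  BoxCompl P.C P.l P.v (xp w) Λ.αx Λ.γx ∧
  (gradient P.θ (yp u)).ofLp + Hy.mulVec (yp w - yp u).ofLp + P.F.transpose.mulVec Λ.μy.ofLp
      + P.D.transpose.mulVec (Λ.γy - Λ.αy) = 0 ∧
  Compl Λ.μy.ofLp ((c / 2) • P.h (xp u) (yp u) - P.h (xp u) (yp w)) ∧
  BoxCompl P.D P.s P.r (yp w) Λ.αy Λ.γy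

/-- `w` solves the joint subproblem at `u`, with multipliers `Λ`. -/
def SolvesJoint (u : Pair n₁ n₂) (Hx : Matrix (Fin n₁) (Fin n₁) ℝ)
    (Hy : Matrix (Fin n₂) (Fin n₂) ℝ) (w : Pair n₁ n₂) (Λ : Mult m l₁ l₂) : Prop :=
  (w ∈ P.feasible ∧
    IsMinOn (fun z => P.qx u Hx (xp z) + P.qy u Hy (yp z)) P.feasible w) ∧
  (gradient P.f (xp u)).ofLp + Hx.mulVec (xp w - xp u).ofLp + P.E.transpose.mulVec Λ.μ.ofLp
      + P.C.transpose.mulVec (Λ.γx - Λ.αx) = 0 ∧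
  (gradient P.θ (yp u)).ofLp + Hy.mulVec (yp w - yp u).ofLp + P.F.transpose.mulVec Λ.μ.ofLp
      + P.D.transpose.mulVec (Λ.γy - Λ.αy) = 0 ∧
  Compl Λ.μ.ofLp (-P.h (xp w) (yp w)) ∧
  BoxCompl P.C P.l P.v (xp w) Λ.αx Λ.γx ∧
  BoxCompl P.D P.s P.r (yp w) Λ.αy Λ.γy

end Problem

/-- Parameters of the method. -/
structure Params where
  c : ℝ
  ρ : ℝ
  σ : ℝ
  τ₁ : ℝ
  M : ℝ
  M₁ : ℝ
  c_mem : c ∈ Set.Icc (0 : ℝ) 1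
  ρ_mem : ρ ∈ Set.Ioo (0 : ℝ) 1
  σ_mem : σ ∈ Set.Ioo (0 : ℝ) 1
  τ₁_pos : 0 < τ₁
  M_pos : 0 < M
  M₁_pos : 0 < M₁

/-- The quantities that occur in an infinite run of the method. At iteration `k`, `us k` and
`Λs k` are the solutions and multipliers of the split subproblems; `uj k` and `Λj k` those of
the joint subproblem (meaningful only if the splitting is rejected); `t k` is the step size. -/
structure Trace (n₁ n₂ m l₁ l₂ : ℕ) where
  u : ℕ → Pair n₁ n₂
  Hx : ℕ → Matrix (Fin n₁) (Fin n₁) ℝ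
  Hy : ℕ → Matrix (Fin n₂) (Fin n₂) ℝ
  us : ℕ → Pair n₁ n₂
  Λs : ℕ → SplitMult m l₁ l₂
  uj : ℕ → Pair n₁ n₂
  Λj : ℕ → Mult m l₁ l₂
  t : ℕ → ℝ

namespace Trace

variable {n₁ n₂ m l₁ l₂ : ℕ} (T : Trace n₁ n₂ m l₁ l₂)

/-- The block diagonal matrix `diag(H_k^x, H_k^y)`. -/
def Hu (k : ℕ) : Matrix (Fin n₁ ⊕ Fin n₂) (Fin n₁ ⊕ Fin n₂) ℝ :=
  Matrix.fromBlocks (T.Hx k) 0 0 (T.Hy k)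

/-- The test that decides whether the splitting is accepted at iteration `k`. -/
def Accepted (p : Params) (k : ℕ) : Prop :=
  min ‖(T.Λs k).μx‖ ‖(T.Λs k).μy‖ ≤ p.M ∧
    ‖(T.Λs k).μx - (T.Λs k).μy‖ ≤ p.M₁ * ‖T.us k - T.u k‖ ^ p.τ₁

open Classical in
/-- The subproblem solution `ũ_{k+1}` used at iteration `k`. -/
def ut (p : Params) (k : ℕ) : Pair n₁ n₂ := if T.Accepted p k then T.us k else T.uj k

/-- The search direction. -/
def d (p : Params) (k : ℕ) : Pair n₁ n₂ := T.ut p k - T.u k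

open Classical in
/-- The largest trial step size. -/
def cmax (p : Params) (k : ℕ) : ℝ := if T.Accepted p k then 1 / (2 - p.c) else 1

/-- `T` is an infinite run of the method with parameters `p` on the problem `P`
(the stopping test `u_{k+1} = u_k` never succeeds). -/
structure IsRun (P : Problem n₁ n₂ m l₁ l₂) (p : Params) : Prop where
  init : T.u 0 ∈ P.feasible
  posDef_x : ∀ k, (T.Hx k).PosDef
  posDef_y : ∀ k, (T.Hy k).PosDef
  split : ∀ k, P.SolvesSplit p.c (T.u k) (T.Hx k) (T.Hy k) (T.us k) (T.Λs k)
  joint : ∀ k, ¬ T.Accepted p k →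
    P.SolvesJoint (T.u k) (T.Hx k) (T.Hy k) (T.uj k) (T.Λj k)
  armijo : ∀ k, IsGreatest
    {t : ℝ | (∃ i : ℕ, t = T.cmax p k * p.σ ^ i) ∧
      P.obj (T.u k + t • T.d p k) ≤ P.obj (T.u k) - p.ρ * t * sqNorm (T.Hu k) (T.d p k)} (T.t k)
  step : ∀ k, T.u (k + 1) = T.u k + T.t k • T.d p k
  not_stopped : ∀ k, T.u (k + 1) ≠ T.u k

/-- The matrices are uniformly positive definite, and bounded along every set of iterations
on which the iterates are bounded. -/
def MatrixAssumption : Prop :=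
  (∃ η : ℝ, 0 < η ∧
    ∀ k, (T.Hu k - η • (1 : Matrix (Fin n₁ ⊕ Fin n₂) (Fin n₁ ⊕ Fin n₂) ℝ)).PosSemidef) ∧
  (∀ K : Set ℕ, Bornology.IsBounded (T.u '' K) →
    ∃ R : ℝ, ∀ k ∈ K, ‖Matrix.toEuclideanCLM (𝕜 := ℝ) (T.Hu k)‖ ≤ R)

open Classical in
/-- The index set `S_k^+`: the coupling constraints active at `ũ_{k+1}` if it solves the joint
subproblem, and those active in both split subproblems otherwise. -/
def Splus (P : Problem n₁ n₂ m l₁ l₂) (p : Params) (k : ℕ) : Finset (Fin m) :=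
  if T.Accepted p k then
    Finset.univ.filter fun i =>
      P.h (xp (T.us k)) (yp (T.u k)) i - p.c / 2 * P.h (xp (T.u k)) (yp (T.u k)) i = 0 ∧
      P.h (xp (T.u k)) (yp (T.us k)) i - p.c / 2 * P.h (xp (T.u k)) (yp (T.u k)) i = 0
  else P.activeS (xp (T.uj k)) (yp (T.uj k))

/-- The projection matrix `P_k` built from the constraints active at iteration `k`. -/
def Pk (P : Problem n₁ n₂ m l₁ l₂) (p : Params) (k : ℕ) :
    Matrix (Fin n₁ ⊕ Fin n₂) (Fin n₁ ⊕ Fin n₂) ℝ :=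
  P.projMatrix (T.Splus P p k) (P.activeX (xp (T.ut p k))) (P.activeY (yp (T.ut p k)))

/-- The error `(H_k - ∇²F(u_k)) d_k` of the second-order approximation. -/
def hessErr (P : Problem n₁ n₂ m l₁ l₂) (p : Params) (k : ℕ) : Pair n₁ n₂ :=
  Matrix.toEuclideanCLM (𝕜 := ℝ) (T.Hu k) (T.d p k) - hess P.obj (T.u k) (T.d p k)

end Trace

end CFDSQO

end

noncomputable section

/-! ### Taylor estimates and the Armijo line search. -/

namespace PolyhedralSQP

variable {V : Type*} [NormedAddCommGroup V] [InnerProductSpace ℝ V] [CompleteSpace V]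

/-! The method is an instance of an abstract scheme: a smooth function on a polyhedron `⟪a i, u⟫ ≤ b
i`, directions `d k` leading to feasible points that carry complementary multipliers, and
stationarity up to a residual of order `‖d k‖ ^ 2`. A joint step has residual zero. In an accepted
split step the two coupling constraints, each contracted by one half, add up to joint feasibility;
the componentwise minimum of the two coupling multipliers is complementary at the merged point; and
the acceptance test with `2 ≤ τ₁` bounds the resulting residual (`SolvesSplit.isMultiplier`,
`IsRun.norm_stationary_le`).

In the abstract scheme (`quadratic_convergence`) Armijo descent forces `d k → 0`. Near the cluster
point LICQ makes the multipliers converge, so constraints with positive limit multiplier become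
active at `u k + d k`. Second-order sufficiency and the monotonicity of the normal cone then bound
the squared distance of `u k + d k` to the solution by the inner product of its KKT residual with
the error (`eventually_coercive`). That residual is `O(‖d k‖)`, so `‖u k - x‖ = O(‖d k‖)`, and the
whole sequence converges because vanishing steps cannot leave a small ball.

The Hessian approximation sharpens the estimate to `‖u k + d k - x‖ = O(‖d k‖ ^ 2)`; it is only
tested on vectors orthogonal to the constraints in use, so the projected condition suffices. The
unit step is eventually accepted because `ρ < 1/2` leaves a positive share of the curvature to
absorb cubic terms, and the uncontrolled part of a projected error is paid for by multipliers
bounded away from zero (`full_step_decrease`). Unit steps turn the sharpened estimate into quadratic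
convergence. -/

lemma norm_gradient_sub (Φ : V → ℝ) (x y : V) :
    ‖gradient Φ x - gradient Φ y‖ = ‖fderiv ℝ Φ x - fderiv ℝ Φ y‖ := by
  unfold gradient
  rw [← map_sub, LinearIsometryEquiv.norm_map]

lemma inner_gradient (Φ : V → ℝ) (x z : V) : inner ℝ (gradient Φ x) z = fderiv ℝ Φ x z := by
  simp [gradient]

lemma contDiffAt_gradient {Φ : V → ℝ} {x : V} {n : ℕ} (h : ContDiffAt ℝ (n + 1 : ℕ) Φ x) :
    ContDiffAt ℝ n (gradient Φ) x := by
  have h1 : ContDiffAt ℝ n (fderiv ℝ Φ) x := h.fderiv_right (by norm_cast)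
  exact (InnerProductSpace.toDual ℝ V).symm.contDiff.contDiffAt.comp x h1

/-- The gradient and its derivative are both locally Lipschitz, and this gives all three estimates
with one radius and one constant, uniformly in the base point; uniformity matters because the
expansions are taken at the moving iterates. -/
lemma exists_taylor {Φ : V → ℝ} {x : V} (h : ContDiffAt ℝ 3 Φ x) :
    ∃ δ > 0, ∃ L ≥ 0, ∀ u ∈ Metric.ball x δ, ∀ w ∈ Metric.ball x δ,
      ‖gradient Φ w - gradient Φ u‖ ≤ L * ‖w - u‖ ∧
      ‖gradient Φ w - gradient Φ u - fderiv ℝ (gradient Φ) u (w - u)‖ ≤ L * ‖w - u‖ ^ 2 ∧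
      Φ w ≤ Φ u + inner ℝ (gradient Φ u) (w - u)
        + 1 / 2 * inner ℝ (w - u) (fderiv ℝ (gradient Φ) u (w - u)) + L * ‖w - u‖ ^ 3 := by
  have hg : ContDiffAt ℝ (2 : ℕ) (gradient Φ) x := contDiffAt_gradient h
  have hh : ContDiffAt ℝ 1 (fderiv ℝ (gradient Φ)) x := hg.fderiv_right (by norm_cast)
  obtain ⟨L₁, s₁, hs₁, hL₁⟩ :=
    (hg.of_le (by norm_cast : ((1 : ℕ) : WithTop ℕ∞) ≤ (2 : ℕ))).exists_lipschitzOnWith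
  obtain ⟨L₂, s₂, hs₂, hL₂⟩ := hh.exists_lipschitzOnWith
  have hdiff : ∀ᶠ y in 𝓝 x, DifferentiableAt ℝ (gradient Φ) y := by
    filter_upwards [hg.eventually (by simp)] with y hy
    exact hy.differentiableAt (by norm_num)
  have hdiffΦ : ∀ᶠ y in 𝓝 x, DifferentiableAt ℝ Φ y := by
    filter_upwards [h.eventually (by decide)] with y hy
    exact hy.differentiableAt (by norm_num)
  obtain ⟨δ, hδ, hball⟩ := Metric.mem_nhds_iff.1
    (inter_mem (inter_mem hs₁ hs₂) (inter_mem hdiff hdiffΦ))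
  have second : ∀ u ∈ Metric.ball x δ, ∀ w ∈ Metric.ball x δ,
      ‖gradient Φ w - gradient Φ u - fderiv ℝ (gradient Φ) u (w - u)‖ ≤ L₂ * ‖w - u‖ ^ 2 := by
    intro u hu w hw
    have hseg : segment ℝ u w ⊆ Metric.ball x δ := (convex_ball x δ).segment_subset hu hw
    -- Mean value inequality for the gradient minus its linearization at `u`.
    have := (convex_segment u w).norm_image_sub_le_of_norm_hasFDerivWithin_le'
      (f := gradient Φ) (f' := fderiv ℝ (gradient Φ)) (φ := fderiv ℝ (gradient Φ) u)
      (C := L₂ * ‖w - u‖)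
      (fun y hy => ((hball (hseg hy)).2.1).hasFDerivAt.hasFDerivWithinAt)
      (fun y hy => by
        have h1 := hL₂.dist_le_mul y (hball (hseg hy)).1.2 u (hball hu).1.2
        rw [dist_eq_norm, dist_eq_norm] at h1
        refine h1.trans (mul_le_mul_of_nonneg_left ?_ L₂.2)
        exact norm_sub_le_of_mem_segment hy)
      (left_mem_segment ℝ u w) (right_mem_segment ℝ u w)
    rw [pow_two, ← mul_assoc]
    exact this
  refine ⟨δ, hδ, L₁ + L₂, by positivity, fun u hu w hw => ⟨?_, ?_, ?_⟩⟩
  · have h1 := hL₁.dist_le_mul w (hball hw).1.1 u (hball hu).1.1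
    rw [dist_eq_norm, dist_eq_norm] at h1
    refine h1.trans (mul_le_mul_of_nonneg_right ?_ (norm_nonneg _))
    simp
  · refine (second u hu w hw).trans (mul_le_mul_of_nonneg_right ?_ (by positivity))
    simp
  · obtain ⟨e, he⟩ : ∃ e, e = w - u := ⟨_, rfl⟩
    rw [← he]
    have hmem : ∀ s ∈ Set.Icc (0 : ℝ) 1, u + s • e ∈ Metric.ball x δ := fun s hs =>
      he ▸ (convex_ball x δ).add_smul_sub_mem hu hw hs
    -- The second-order Taylor remainder along the segment. Its derivative is the gradient remainder
    -- paired with `e`, so a single mean value point gives the cubic bound.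
    let ψ : ℝ → ℝ := fun s => Φ (u + s • e) - s * inner ℝ (gradient Φ u) e
      - s ^ 2 / 2 * inner ℝ e (fderiv ℝ (gradient Φ) u e)
    have hder : ∀ s ∈ Set.Icc (0 : ℝ) 1, HasDerivAt ψ
        (inner ℝ (gradient Φ (u + s • e)) e - inner ℝ (gradient Φ u) e
          - s * inner ℝ e (fderiv ℝ (gradient Φ) u e)) s := by
      intro s hs
      have h1 : HasDerivAt (fun s : ℝ => u + s • e) e s := by
        simpa using ((hasDerivAt_id s).smul_const e).const_add u
      have h2 := ((hball (hmem s hs)).2.2).hasFDerivAt.comp_hasDerivAt s h1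
      rw [← inner_gradient] at h2
      have h3 := (hasDerivAt_id s).mul_const (inner ℝ (gradient Φ u) e)
      have h4 := (((hasDerivAt_id s).pow 2).div_const 2).mul_const
        (inner ℝ e (fderiv ℝ (gradient Φ) u e))
      refine ((h2.sub h3).sub h4).congr_deriv ?_
      simp only [id, one_mul, Nat.cast_ofNat]
      ring
    have hbound : ∀ s ∈ Set.Icc (0 : ℝ) 1,
        inner ℝ (gradient Φ (u + s • e)) e - inner ℝ (gradient Φ u) e
          - s * inner ℝ e (fderiv ℝ (gradient Φ) u e) ≤ L₂ * ‖e‖ ^ 3 := by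
      intro s hs
      have h1 := second u hu _ (hmem s hs)
      rw [add_sub_cancel_left, map_smul, norm_smul, Real.norm_of_nonneg hs.1] at h1
      have h2 : inner ℝ (gradient Φ (u + s • e)) e - inner ℝ (gradient Φ u) e
          - s * inner ℝ e (fderiv ℝ (gradient Φ) u e) =
          inner ℝ (gradient Φ (u + s • e) - gradient Φ u - s • fderiv ℝ (gradient Φ) u e) e := by
        rw [inner_sub_left, inner_sub_left, real_inner_smul_left, real_inner_comm (fderiv ℝ (gradient Φ) u e)]
      rw [h2]
      refine (real_inner_le_norm _ _).trans ((mul_le_mul_of_nonneg_right h1 (norm_nonneg _)).trans ?_)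
      have h3 : (s * ‖e‖) ^ 2 ≤ ‖e‖ ^ 2 :=
        pow_le_pow_left₀ (mul_nonneg hs.1 (norm_nonneg _))
          (mul_le_of_le_one_left (norm_nonneg _) hs.2) 2
      calc L₂ * (s * ‖e‖) ^ 2 * ‖e‖ ≤ L₂ * ‖e‖ ^ 2 * ‖e‖ := by gcongr
        _ = L₂ * ‖e‖ ^ 3 := by ring
    obtain ⟨s, hs, hslope⟩ := exists_hasDerivAt_eq_slope ψ _ one_pos
      (fun s hs => (hder s hs).continuousAt.continuousWithinAt)
      (fun s hs => hder s (Set.Ioo_subset_Icc_self hs))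
    have h5 := hbound s (Set.Ioo_subset_Icc_self hs)
    rw [hslope] at h5
    have h6 : u + e = w := by simp [he]
    simp only [ψ, one_smul, h6, zero_smul, add_zero] at h5
    have h7 : (0 : ℝ) ≤ L₁ * ‖e‖ ^ 3 := by positivity
    linarith

/-- Armijo line search along gradient-related directions drives the directions to zero. -/
lemma tendsto_direction_zero [FiniteDimensional ℝ V] {Φ : V → ℝ} (hΦ : ContDiff ℝ 1 Φ)
    {u d : ℕ → V} {t q : ℕ → ℝ} {ρ σ η : ℝ} (hρ : ρ ∈ Set.Ioo (0 : ℝ) 1)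
    (hσ : σ ∈ Set.Ioo (0 : ℝ) 1) (hη : 0 < η) (hq : ∀ k, η * ‖d k‖ ^ 2 ≤ q k)
    (hdesc : ∀ k, inner ℝ (gradient Φ (u k)) (d k) ≤ -q k)
    (harm : ∀ k, IsGreatest {s : ℝ | (∃ i : ℕ, s = σ ^ i) ∧
      Φ (u k + s • d k) ≤ Φ (u k) - ρ * s * q k} (t k))
    (hstep : ∀ k, u (k + 1) = u k + t k • d k) (hbdd : Bornology.IsBounded (Set.range u)) :
    Tendsto d atTop (𝓝 0) := by
  obtain ⟨R, hR⟩ := hbdd.subset_closedBall 0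
  have huR : ∀ k, ‖u k‖ ≤ R := fun k => by simpa using hR (Set.mem_range_self k)
  have hcg : Continuous (gradient Φ) := by
    have := hΦ.continuous_fderiv (by norm_num)
    exact (InnerProductSpace.toDual ℝ V).symm.continuous.comp this
  -- The extra radius 1 leaves room for rejected trial points.
  have huc : UniformContinuousOn (gradient Φ) (Metric.closedBall 0 (R + 1)) :=
    (isCompact_closedBall _ _).uniformContinuousOn_of_continuous hcg.continuousOn
  have htpos : ∀ k, 0 < t k := fun k => by
    obtain ⟨⟨i, hi⟩, -⟩ := (harm k).1
    rw [hi]; exact pow_pos hσ.1 i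
  have hq0 : ∀ k, 0 ≤ q k := fun k => le_trans (by positivity) (hq k)
  have hdec : ∀ k, ρ * t k * q k ≤ Φ (u k) - Φ (u (k + 1)) := fun k => by
    have := (harm k).1.2
    rw [← hstep] at this; linarith
  have hanti : Antitone fun k => Φ (u k) := antitone_nat_of_succ_le fun k => by
    have h1 := hdec k
    have : 0 ≤ ρ * t k * q k := mul_nonneg (mul_nonneg hρ.1.le (htpos k).le) (hq0 k)
    linarith
  have hbb : BddBelow (Set.range fun k => Φ (u k)) := by
    have hc := (isCompact_closedBall (0 : V) R).bddBelow_image hΦ.continuous.continuousOn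
    refine hc.mono ?_
    rintro _ ⟨k, rfl⟩
    exact ⟨u k, hR (Set.mem_range_self k), rfl⟩
  have hconv := tendsto_atTop_ciInf hanti hbb
  have hdiff : Tendsto (fun k => Φ (u k) - Φ (u (k + 1))) atTop (𝓝 0) := by
    simpa using hconv.sub (hconv.comp (tendsto_add_atTop_nat 1))
  have htd : Tendsto (fun k => t k * ‖d k‖ ^ 2) atTop (𝓝 0) := by
    have h1 : Tendsto (fun k => (ρ * η)⁻¹ * (Φ (u k) - Φ (u (k + 1)))) atTop (𝓝 0) := by
      simpa using hdiff.const_mul (ρ * η)⁻¹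
    refine squeeze_zero (fun k => mul_nonneg (htpos k).le (by positivity)) (fun k => ?_) h1
    have hρη : 0 < ρ * η := mul_pos hρ.1 hη
    rw [le_inv_mul_iff₀ hρη]
    refine le_trans ?_ (hdec k)
    have := mul_le_mul_of_nonneg_left (hq k) (mul_nonneg hρ.1.le (htpos k).le)
    linarith
  rw [Metric.tendsto_atTop']
  intro ε hε
  have hρ1 : 0 < 1 - ρ := by linarith [hρ.2]
  obtain ⟨δ, hδ, hδu⟩ := Metric.uniformContinuousOn_iff.1 huc ((1 - ρ) * η * ε) (by positivity)
  have hσ0 := hσ.1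
  -- If `‖d k‖ ≥ ε`, the first entry rules out a unit step, and the second makes the last rejected
  -- trial displacement shorter than `min (δ / 2) 1`.
  have hpos : 0 < min (ε ^ 2) (ε * (σ * min (δ / 2) 1)) :=
    lt_min (pow_pos hε 2) (mul_pos hε (mul_pos hσ0 (lt_min (half_pos hδ) one_pos)))
  have hev := htd.eventually_lt_const hpos
  obtain ⟨N, hN⟩ := eventually_atTop.1 hev
  refine ⟨N, fun k hk => ?_⟩
  rw [dist_zero_right]
  by_contra! hd
  have hdpos : 0 < ‖d k‖ := hε.trans_le hd
  have hk1 := (hN k hk.le).trans_le (min_le_left _ _)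
  have hk2 := (hN k hk.le).trans_le (min_le_right _ _)
  have ht1 : t k < 1 := by
    by_contra! h1
    have : ε ^ 2 ≤ ‖d k‖ ^ 2 := by gcongr
    nlinarith [sq_nonneg ‖d k‖]
  have htd1 : t k * ‖d k‖ < σ * min (δ / 2) 1 := by
    have h1 : t k * ‖d k‖ * ε ≤ t k * ‖d k‖ ^ 2 := by
      rw [pow_two, ← mul_assoc]
      exact mul_le_mul_of_nonneg_left hd (mul_nonneg (htpos k).le hdpos.le)
    nlinarith
  obtain ⟨⟨i, hi⟩, -⟩ := (harm k).1
  obtain _ | i := i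
  · simp [hi] at ht1
  -- The last rejected trial step, one factor `σ` larger than the accepted one; it fails the Armijo
  -- test by maximality.
  set s := σ ^ i with hs
  have hspos : 0 < s := pow_pos hσ.1 i
  have hts : t k = s * σ := by rw [hi, pow_succ]
  have hsd : s * ‖d k‖ < min (δ / 2) 1 := by
    rw [hts] at htd1
    by_contra! h1
    nlinarith
  have hfail : Φ (u k) - ρ * s * q k < Φ (u k + s • d k) := by
    by_contra! h1
    have h2 := (harm k).2 ⟨⟨i, rfl⟩, h1⟩
    rw [hts] at h2
    nlinarith [hσ.2]
  have hmvt := (convex_segment (u k) (u k + s • d k)).norm_image_sub_le_of_norm_hasFDerivWithin_le'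
      (f := Φ) (f' := fderiv ℝ Φ) (φ := fderiv ℝ Φ (u k)) (C := (1 - ρ) * η * ε)
      (fun y _ => (hΦ.differentiable (by norm_num) y).hasFDerivAt.hasFDerivWithinAt)
      (fun y hy => by
        have h1 := norm_sub_le_of_mem_segment hy
        rw [add_sub_cancel_left, norm_smul, Real.norm_of_nonneg hspos.le] at h1
        have h2 := hsd.trans_le (min_le_left _ _)
        have h3 := hsd.trans_le (min_le_right _ _)
        rw [← norm_gradient_sub, ← dist_eq_norm]
        refine (hδu y ?_ (u k) ?_ ?_).le
        · rw [mem_closedBall_zero_iff]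
          calc ‖y‖ = ‖u k + (y - u k)‖ := by simp
            _ ≤ ‖u k‖ + ‖y - u k‖ := norm_add_le _ _
            _ ≤ R + 1 := add_le_add (huR k) (by linarith)
        · rw [mem_closedBall_zero_iff]; linarith [huR k]
        · rw [dist_eq_norm]; linarith)
      (left_mem_segment ℝ _ _) (right_mem_segment ℝ _ _)
  rw [add_sub_cancel_left, map_smul, ← inner_gradient, norm_smul, Real.norm_of_nonneg hspos.le,
    smul_eq_mul] at hmvt
  have h1 := (le_abs_self _).trans hmvt
  have h2 := mul_le_mul_of_nonneg_left (hdesc k) hspos.le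
  have h3 : (1 - ρ) * s * q k < (1 - ρ) * η * ε * (s * ‖d k‖) := by linarith
  -- Failure of the test at `s` together with the mean value bound gives `q k < η * ε * ‖d k‖`,
  -- which this contradicts.
  have h4 : η * (ε * ‖d k‖) ≤ q k := by
    refine le_trans ?_ (hq k)
    rw [pow_two]
    gcongr
  have h5 := mul_le_mul_of_nonneg_left h4 (mul_pos hρ1 hspos).le
  linarith

end PolyhedralSQP

/-! ### Multipliers, coercivity and error bounds. -/

namespace PolyhedralSQP

variable {V : Type*} [NormedAddCommGroup V] [InnerProductSpace ℝ V]

/-- `lam` is a nonnegative vector complementary to the constraints `⟪a i, w⟫ ≤ b i` at the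
feasible point `w`. -/
structure IsMultiplier {ι : Type*} (a : ι → V) (b : ι → ℝ) (w : V) (lam : ι → ℝ) : Prop where
  feasible : ∀ i, inner ℝ (a i) w ≤ b i
  nonneg : ∀ i, 0 ≤ lam i
  compl : ∀ i, lam i ≠ 0 → inner ℝ (a i) w = b i

section Multipliers

variable {ι : Type*} [Fintype ι] {a : ι → V} {b : ι → ℝ}

/-- Monotonicity of the normal cone: complementarity removes the matched terms and leaves
multipliers times slacks of the other point. -/
lemma IsMultiplier.inner_sub_nonneg {w v : V} {lam ν : ι → ℝ} (hw : IsMultiplier a b w lam)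
    (hv : IsMultiplier a b v ν) :
    0 ≤ inner ℝ (∑ i, lam i • a i - ∑ i, ν i • a i) (w - v) := by
  rw [← Finset.sum_sub_distrib, sum_inner]
  refine Finset.sum_nonneg fun i _ => ?_
  rw [← sub_smul, real_inner_smul_left, inner_sub_right]
  have h1 : lam i * (b i - inner ℝ (a i) w) = 0 := by
    by_cases h : lam i = 0
    · simp [h]
    · simp [hw.compl i h]
  have h2 : ν i * (b i - inner ℝ (a i) v) = 0 := by
    by_cases h : ν i = 0
    · simp [h]
    · simp [hv.compl i h]
  have h3 := mul_nonneg (hw.nonneg i) (sub_nonneg.2 (hv.feasible i))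
  have h4 := mul_nonneg (hv.nonneg i) (sub_nonneg.2 (hw.feasible i))
  linarith

/-- Dual vectors of the active normals read single multipliers off their combination; this is the
form in which LICQ enters. -/
lemma inner_sum_dual [DecidableEq ι] {x : V} {e : ι → V}
    (he : ∀ i j, inner ℝ (a i) x = b i → inner ℝ (a j) x = b j →
      inner ℝ (a i) (e j) = if i = j then (1 : ℝ) else 0)
    {lam : ι → ℝ} (hlam : ∀ i, lam i ≠ 0 → inner ℝ (a i) x = b i) {j : ι}
    (hj : inner ℝ (a j) x = b j) : inner ℝ (∑ i, lam i • a i) (e j) = lam j := by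
  rw [sum_inner, Finset.sum_eq_single j]
  · rw [real_inner_smul_left, he j j hj hj]; simp
  · intro i _ hij
    rw [real_inner_smul_left]
    by_cases h : lam i = 0
    · simp [h]
    · rw [he i j (hlam i h) hj]; simp [hij]
  · simp

/-- Under linear independence of the active gradients, multipliers at points converging to `x`
converge as soon as the corresponding combinations of gradients do. -/
lemma exists_limit_multiplier [DecidableEq ι] {x : V} {e : ι → V}
    (he : ∀ i j, inner ℝ (a i) x = b i → inner ℝ (a j) x = b j →
      inner ℝ (a i) (e j) = if i = j then (1 : ℝ) else 0)
    {l : Filter ℕ} [l.NeBot] {w : ℕ → V} {lam : ℕ → ι → ℝ} {g : V}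
    (hw : Tendsto w l (𝓝 x)) (hmult : ∀ k, IsMultiplier a b (w k) (lam k))
    (hg : Tendsto (fun k => ∑ i, lam k i • a i) l (𝓝 g)) :
    (∀ᶠ k in l, ∀ i, inner ℝ (a i) (w k) = b i → inner ℝ (a i) x = b i) ∧
    ∃ ν : ι → ℝ, IsMultiplier a b x ν ∧ ∑ i, ν i • a i = g ∧
      ∀ i, Tendsto (fun k => lam k i) l (𝓝 (ν i)) := by
  classical
  have hin : ∀ i, Tendsto (fun k => inner ℝ (a i) (w k)) l (𝓝 (inner ℝ (a i) x)) := fun i =>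
    tendsto_const_nhds.inner hw
  have hfeas : ∀ i, inner ℝ (a i) x ≤ b i := fun i =>
    le_of_tendsto (hin i) (Eventually.of_forall fun k => (hmult k).feasible i)
  have hact : ∀ᶠ k in l, ∀ i, inner ℝ (a i) (w k) = b i → inner ℝ (a i) x = b i := by
    rw [eventually_all]
    intro i
    rcases (hfeas i).lt_or_eq with h | h
    · filter_upwards [(hin i).eventually_lt_const h] with k hk hk'
      exact absurd hk' hk.ne
    · exact Eventually.of_forall fun _ _ => h
  refine ⟨hact, ?_⟩
  -- A constraint inactive at `x` is eventually inactive at `w k`, so its multiplier is eventually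
  -- zero.
  let ν : ι → ℝ := fun i => if inner ℝ (a i) x = b i then inner ℝ g (e i) else 0
  have hν : ∀ i, Tendsto (fun k => lam k i) l (𝓝 (ν i)) := by
    intro i
    by_cases h : inner ℝ (a i) x = b i
    · simp only [ν, h, if_true]
      refine (hg.inner (tendsto_const_nhds (x := e i))).congr' ?_
      filter_upwards [hact] with k hk
      exact inner_sum_dual he (fun j hj => hk j ((hmult k).compl j hj)) h
    · simp only [ν, h, if_false]
      refine tendsto_const_nhds.congr' ?_
      filter_upwards [hact] with k hk
      by_contra h0
      exact h (hk i ((hmult k).compl i (Ne.symm h0)))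
  refine ⟨ν, ⟨hfeas, fun i => ge_of_tendsto (hν i)
    (Eventually.of_forall fun k => (hmult k).nonneg i), fun i hi => ?_⟩, ?_, hν⟩
  · by_contra h
    simp [ν, h] at hi
  · exact tendsto_nhds_unique (tendsto_finsetSum _ fun i _ => (hν i).smul_const (a i)) hg

end Multipliers

/-- A quadratic form that is positive on a subspace is uniformly so. -/
lemma exists_coercive [FiniteDimensional ℝ V] {ι : Type*} (a : ι → V) (Q : V →L[ℝ] V)
    (hQ : ∀ z, z ≠ 0 → (∀ i, inner ℝ (a i) z = 0) → 0 < inner ℝ z (Q z)) :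
    ∃ c > 0, ∀ z, (∀ i, inner ℝ (a i) z = 0) → c * ‖z‖ ^ 2 ≤ inner ℝ z (Q z) := by
  set S : Set V := Metric.sphere 0 1 ∩ {z | ∀ i, inner ℝ (a i) z = 0} with hS
  have hclosed : IsClosed {z : V | ∀ i, inner ℝ (a i) z = 0} := by
    rw [Set.ofPred_forall]
    exact isClosed_iInter fun i => isClosed_eq (by fun_prop) continuous_const
  have hcomp : IsCompact S := (isCompact_sphere _ _).inter_right hclosed
  have hscale : ∀ c : ℝ, (∀ z ∈ S, c ≤ inner ℝ z (Q z)) →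
      ∀ z, (∀ i, inner ℝ (a i) z = 0) → c * ‖z‖ ^ 2 ≤ inner ℝ z (Q z) := by
    intro c hc z hz
    by_cases h0 : z = 0
    · simp [h0]
    have hn : 0 < ‖z‖ := norm_pos_iff.2 h0
    have h1 := hc (‖z‖⁻¹ • z) ⟨by simp [norm_smul, hn.ne'], fun i => by
      rw [real_inner_smul_right, hz i, mul_zero]⟩
    rw [map_smul, real_inner_smul_left, real_inner_smul_right] at h1
    have h2 := mul_le_mul_of_nonneg_right h1 (sq_nonneg ‖z‖)
    refine h2.trans (le_of_eq ?_)
    field_simp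
  -- The intersection with the sphere is empty when the subspace is trivial; then any constant
  -- works.
  rcases S.eq_empty_or_nonempty with h | h
  · exact ⟨1, one_pos, hscale 1 (by simp [h])⟩
  · obtain ⟨z, hz, hmin⟩ := hcomp.exists_isMinOn h
      (f := fun z => inner ℝ z (Q z)) (by fun_prop)
    refine ⟨_, hQ z ?_ hz.2, hscale _ fun y hy => hmin hy⟩
    rintro rfl
    simpa using hz.1

/-- Iterates with vanishing steps that satisfy a local error bound at a cluster point converge. -/
lemma tendsto_of_error_bound {W : Type*} [NormedAddCommGroup W] {u d : ℕ → W} {x : W} {C : ℝ}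
    (hstep : ∀ k, ‖u (k + 1) - u k‖ ≤ ‖d k‖) (hd : Tendsto d atTop (𝓝 0))
    (hne : (atTop ⊓ comap u (𝓝 x)).NeBot)
    (hb : ∀ᶠ k in atTop ⊓ comap u (𝓝 x), ‖u k - x‖ ≤ C * ‖d k‖) : Tendsto u atTop (𝓝 x) := by
  have hdn : Tendsto (fun k => ‖d k‖) atTop (𝓝 0) := by simpa using hd.norm
  obtain ⟨p, hp, q, hq, hpq⟩ := eventually_inf.1 hb
  obtain ⟨s, hs, hsq⟩ := mem_comap.1 hq
  obtain ⟨δ, hδ, hball⟩ := Metric.mem_nhds_iff.1 hs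
  -- `C` for the distance of the current iterate and 1 for the step: the next iterate stays in the
  -- ball, so the error bound applies again.
  have hsmall : ∀ᶠ k in atTop, (C + 1) * ‖d k‖ < δ := by
    have := hdn.const_mul (C + 1)
    rw [mul_zero] at this
    exact this.eventually_lt_const hδ
  obtain ⟨N, hN⟩ := eventually_atTop.1 (hsmall.and hp)
  have hex : ∃ k ≥ N, ‖u k - x‖ < δ := by
    have h1 : ∀ᶠ k in atTop ⊓ comap u (𝓝 x), N ≤ k ∧ ‖u k - x‖ < δ := by
      refine ((eventually_ge_atTop N).filter_mono inf_le_left).and ?_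
      refine Eventually.filter_mono inf_le_right ?_
      refine (tendsto_comap.eventually (Metric.ball_mem_nhds x hδ)).mono fun k hk => ?_
      rwa [← dist_eq_norm]
    exact h1.exists
  obtain ⟨k₀, hk₀, hclose⟩ := hex
  have hbound : ∀ k ≥ k₀, ‖u k - x‖ < δ → ‖u k - x‖ ≤ C * ‖d k‖ := fun k hk h =>
    hpq k ⟨(hN k (hk₀.trans hk)).2, hsq (hball (by rwa [mem_ball_iff_norm]))⟩
  have hall : ∀ k ≥ k₀, ‖u k - x‖ < δ := by
    intro k hk
    induction k, hk using Nat.le_induction with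
    | base => exact hclose
    | succ k hk ih =>
      have h1 := hbound k hk ih
      have h2 := (hN k (hk₀.trans hk)).1
      calc ‖u (k + 1) - x‖ = ‖(u (k + 1) - u k) + (u k - x)‖ := by congr 1; abel
        _ ≤ ‖u (k + 1) - u k‖ + ‖u k - x‖ := norm_add_le _ _
        _ < δ := by linarith [hstep k]
  rw [tendsto_iff_norm_sub_tendsto_zero]
  have h0 : Tendsto (fun k => C * ‖d k‖) atTop (𝓝 0) := by simpa using hdn.const_mul C
  refine squeeze_zero' (Eventually.of_forall fun _ => norm_nonneg _) ?_ h0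
  filter_upwards [eventually_ge_atTop k₀] with k hk
  exact hbound k hk (hall k hk)

/-- The strong second-order condition makes the residual of perturbed optimality systems control
the distance to the solution. -/
lemma eventually_coercive [CompleteSpace V] [FiniteDimensional ℝ V] {ι : Type*} [Fintype ι]
    {a : ι → V} {b : ι → ℝ}
    {Φ : V → ℝ} {x : V} (hΦ : ContDiffAt ℝ 3 Φ x) {ν : ι → ℝ} (hν : IsMultiplier a b x ν)
    (hstat : gradient Φ x + ∑ i, ν i • a i = 0)
    (hpos : ∀ z, z ≠ 0 → (∀ i, 0 < ν i → inner ℝ (a i) z = 0) →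
      0 < inner ℝ z (fderiv ℝ (gradient Φ) x z)) :
    ∃ c > 0, ∀ (l : Filter ℕ) (w : ℕ → V) (lam : ℕ → ι → ℝ), Tendsto w l (𝓝 x) →
      (∀ k, IsMultiplier a b (w k) (lam k)) → (∀ i, Tendsto (fun k => lam k i) l (𝓝 (ν i))) →
      ∀ᶠ k in l, c * ‖w k - x‖ ^ 2 ≤
        inner ℝ (gradient Φ (w k) + ∑ i, lam k i • a i) (w k - x) := by
  obtain ⟨c, hc, hcoer⟩ := exists_coercive (fun i : {i // 0 < ν i} => a i)
    (fderiv ℝ (gradient Φ) x) (fun z hz h => hpos z hz fun i hi => h ⟨i, hi⟩)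
  obtain ⟨δ, hδ, L, hL, htay⟩ := exists_taylor hΦ
  refine ⟨c / 2, half_pos hc, fun l w lam hw hmult hlam => ?_⟩
  have hnear : ∀ᶠ k in l, w k ∈ Metric.ball x δ := hw (Metric.ball_mem_nhds x hδ)
  have hsmall : ∀ᶠ k in l, L * ‖w k - x‖ < c / 2 := by
    have h1 := (tendsto_iff_norm_sub_tendsto_zero.1 hw).const_mul L
    rw [mul_zero] at h1
    exact h1.eventually_lt_const (half_pos hc)
  have hpos' : ∀ᶠ k in l, ∀ i, 0 < ν i → 0 < lam k i := by
    rw [eventually_all]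
    intro i
    by_cases h : 0 < ν i
    · exact ((hlam i).eventually_const_lt h).mono fun _ hk _ => hk
    · exact Eventually.of_forall fun _ h' => absurd h' h
  filter_upwards [hnear, hsmall, hpos'] with k hk hks hkp
  obtain ⟨z, hz⟩ : ∃ z, z = w k - x := ⟨_, rfl⟩
  -- Positive multipliers at both points make the constraint tight at both, so the difference lies
  -- in the null space where the Hessian is coercive.
  have hker : ∀ i : {i // 0 < ν i}, inner ℝ (a i) z = 0 := fun i => by
    rw [hz, inner_sub_right, (hmult k).compl i (hkp i i.2).ne', hν.compl i i.2.ne', sub_self]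
  have h1 := hcoer z hker
  have h2 := (htay x (Metric.mem_ball_self hδ) _ hk).2.1
  have h3 := (hmult k).inner_sub_nonneg hν
  rw [← hz] at h2 h3 hks ⊢
  have h4 := (abs_le.1 ((abs_real_inner_le_norm _ z).trans
    (mul_le_mul_of_nonneg_right h2 (norm_nonneg z)))).1
  -- Taylor remainder, multiplier difference (nonnegative against `z` by monotonicity) and Hessian
  -- term; half of the coercivity absorbs the remainder.
  have h5 : gradient Φ (w k) + ∑ i, lam k i • a i =
      (gradient Φ (w k) - gradient Φ x - fderiv ℝ (gradient Φ) x z)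
        + (∑ i, lam k i • a i - ∑ i, ν i • a i) + fderiv ℝ (gradient Φ) x z := by
    have : gradient Φ x = -∑ i, ν i • a i := eq_neg_of_add_eq_zero_left hstat
    rw [this]; abel
  rw [h5, inner_add_left, inner_add_left, real_inner_comm z (fderiv ℝ (gradient Φ) x z)]
  have h6 := mul_le_mul_of_nonneg_right hks.le (sq_nonneg ‖z‖)
  nlinarith

end PolyhedralSQP

/-! ### Acceptance of the unit step and the abstract convergence theorem. -/

namespace PolyhedralSQP

variable {V : Type*} [NormedAddCommGroup V] [InnerProductSpace ℝ V] [CompleteSpace V]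
  {ι : Type*} [Fintype ι]

/-- A sufficient condition for acceptance of the full step: the curvature error is small on the
null space of the constraints in `A`, and the multipliers of those constraints are bounded below
relative to the direction. -/
lemma full_step_decrease [DecidableEq ι] {a : ι → V} {b : ι → ℝ} {x : V} {e : ι → V}
    (he : ∀ i j, inner ℝ (a i) x = b i → inner ℝ (a j) x = b j →
      inner ℝ (a i) (e j) = if i = j then (1 : ℝ) else 0)
    {Φ : V → ℝ} {u d : V} {H Q : V →L[ℝ] V} {lam : ι → ℝ} {A : Set ι}
    {ρ η R K K' L : ℝ} (hL : 0 ≤ L) (hK' : 0 ≤ K')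
    (hcoer : η * ‖d‖ ^ 2 ≤ inner ℝ d (H d)) (hHR : ‖H‖ ≤ R)
    (hmult : IsMultiplier a b (u + d) lam) (hfeas : ∀ i, inner ℝ (a i) u ≤ b i)
    (hstat : ‖gradient Φ u + H d + ∑ i, lam i • a i‖ ≤ K * ‖d‖ ^ 2)
    (hA : ∀ i ∈ A, inner ℝ (a i) (u + d) = b i ∧ inner ℝ (a i) x = b i)
    (hE : ∀ z, (∀ i ∈ A, inner ℝ (a i) z = 0) →
      |inner ℝ (H d - Q d) z| ≤ K' * ‖d‖ ^ 2 * ‖z‖)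
    (hQ : ‖Q d‖ ≤ 2 * L * ‖d‖) (hd1 : ‖d‖ ≤ 1)
    (htay : Φ (u + d) ≤ Φ u + inner ℝ (gradient Φ u) d + 1 / 2 * inner ℝ d (Q d) + L * ‖d‖ ^ 3)
    (hlam : ∀ i ∈ A, (K' + R + 2 * L) * ‖d‖ * ‖e i‖ ≤ lam i)
    (hsmall : (K + K' + L) * ‖d‖ ≤ (1 / 2 - ρ) * η) (hρ : ρ < 1 / 2) :
    Φ (u + d) ≤ Φ u - ρ * inner ℝ d (H d) := by
  classical
  have hR : 0 ≤ R := (norm_nonneg _).trans hHR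
  have hslack : ∀ i, lam i * inner ℝ (a i) d = lam i * (b i - inner ℝ (a i) u) := fun i => by
    by_cases h : lam i = 0
    · simp [h]
    · rw [← hmult.compl i h, inner_add_right]; ring
  -- The constraints in `A` are tight at `u + d` but perhaps not at `u`, so `d` need not lie in
  -- their null space. Their slacks `s` at `u` define a correction `n` for which `d - n` does.
  let s : ι → ℝ := fun i => if i ∈ A then inner ℝ (a i) d else 0
  have hs0 : ∀ i, 0 ≤ s i := fun i => by
    by_cases h : i ∈ A
    · have h1 := (hA i h).1
      rw [inner_add_right] at h1
      simp only [s, h, if_true]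
      linarith [hfeas i]
    · simp [s, h]
  let n : V := ∑ i, s i • e i
  have hn : ∀ j ∈ A, inner ℝ (a j) n = inner ℝ (a j) d := fun j hj => by
    simp only [n]
    rw [inner_sum, Finset.sum_eq_single j]
    · rw [real_inner_smul_right, he j j (hA j hj).2 (hA j hj).2]; simp [s, hj]
    · intro i _ hij
      rw [real_inner_smul_right]
      by_cases h : i ∈ A
      · rw [he j i (hA j hj).2 (hA i h).2]; simp [Ne.symm hij]
      · simp [s, h]
    · simp
  have hnn : ‖n‖ ≤ ∑ i, s i * ‖e i‖ := (norm_sum_le _ _).trans (le_of_eq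
    (Finset.sum_congr rfl fun i _ => by rw [norm_smul, Real.norm_of_nonneg (hs0 i)]))
  set B := ∑ i, s i * ‖e i‖ with hB
  have hB0 : 0 ≤ B := (norm_nonneg _).trans hnn
  have h1 := hE (d - n) fun i hi => by rw [inner_sub_right, hn i hi, sub_self]
  have hEn : ‖H d - Q d‖ ≤ (R + 2 * L) * ‖d‖ := by
    refine (norm_sub_le _ _).trans ?_
    rw [add_mul]
    exact add_le_add (H.le_of_opNorm_le hHR d) hQ
  have h2 : |inner ℝ (H d - Q d) n| ≤ (R + 2 * L) * ‖d‖ * B :=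
    (abs_real_inner_le_norm _ _).trans (mul_le_mul hEn hnn (norm_nonneg _) (by positivity))
  have h3 : ‖d - n‖ ≤ ‖d‖ + B := (norm_sub_le _ _).trans (by linarith)
  have h4 : |inner ℝ (H d - Q d) (d - n)| ≤ K' * ‖d‖ ^ 3 + K' * ‖d‖ * B := by
    refine h1.trans ((mul_le_mul_of_nonneg_left h3 (by positivity)).trans ?_)
    have h5 : ‖d‖ ^ 2 ≤ ‖d‖ := by nlinarith [norm_nonneg d]
    have h6 := mul_le_mul_of_nonneg_right (mul_le_mul_of_nonneg_left h5 hK') hB0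
    nlinarith
  have h5 : inner ℝ d (Q d) = inner ℝ d (H d) - inner ℝ (H d - Q d) (d - n)
      - inner ℝ (H d - Q d) n := by
    rw [inner_sub_right, inner_sub_left, inner_sub_left, real_inner_comm d (H d),
      real_inner_comm d (Q d)]
    ring
  have h6 : inner ℝ (gradient Φ u) d ≤ K * ‖d‖ ^ 3 - inner ℝ d (H d)
      - ∑ i, lam i * inner ℝ (a i) d := by
    have h7 : gradient Φ u = (gradient Φ u + H d + ∑ i, lam i • a i) - H d
      - ∑ i, lam i • a i := by abel
    have h8 := (real_inner_le_norm _ d).trans (mul_le_mul_of_nonneg_right hstat (norm_nonneg d))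
    rw [h7, inner_sub_left, inner_sub_left, sum_inner, real_inner_comm d (H d)]
    simp only [real_inner_smul_left]
    nlinarith
  -- The curvature error on `n` is not of higher order in `‖d‖` alone, but it is proportional to the
  -- slacks, and multipliers times slacks already count as decrease.
  have h7 : (K' + R + 2 * L) * ‖d‖ * B ≤ ∑ i, lam i * inner ℝ (a i) d := by
    rw [hB, Finset.mul_sum]
    refine Finset.sum_le_sum fun i _ => ?_
    by_cases h : i ∈ A
    · have h8 := mul_le_mul_of_nonneg_right (hlam i h) (hs0 i)
      have h9 : s i = inner ℝ (a i) d := by simp [s, h]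
      rw [← h9]; linarith
    · have h8 := mul_nonneg (hmult.nonneg i) (sub_nonneg.2 (hfeas i))
      rw [hslack]; simpa [s, h] using h8
  have h8 : 0 ≤ (K' + R + 2 * L) * ‖d‖ * B := by positivity
  -- The quadratic model gives a decrease of half the curvature, the test asks for the fraction `ρ`;
  -- the surplus absorbs the cubic terms.
  have h9 : (K + K' + L) * ‖d‖ ^ 3 ≤ (1 / 2 - ρ) * inner ℝ d (H d) := by
    have h10 := mul_le_mul_of_nonneg_right hsmall (sq_nonneg ‖d‖)
    have h11 := mul_le_mul_of_nonneg_left hcoer (sub_nonneg.2 hρ.le)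
    nlinarith
  have h12 := neg_abs_le (inner ℝ (H d - Q d) (d - n))
  have h13 := neg_abs_le (inner ℝ (H d - Q d) n)
  have h14 : 0 ≤ K' * ‖d‖ ^ 3 := by positivity
  rw [h5] at htay
  linarith

/-- Local quadratic convergence of a feasible sequential quadratic optimization method with
Armijo line search for a polyhedral feasible set. -/
theorem quadratic_convergence [FiniteDimensional ℝ V] [DecidableEq ι] {a : ι → V} {b : ι → ℝ} {Φ : V → ℝ}
    (hΦ : ContDiff ℝ 1 Φ) {x : V}
    (hC3 : (∀ i, inner ℝ (a i) x ≤ b i) → ContDiffAt ℝ 3 Φ x)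
    {u d : ℕ → V} {t : ℕ → ℝ} {H : ℕ → V →L[ℝ] V} {lam : ℕ → ι → ℝ} {ρ σ η R K K' : ℝ}
    (hρ0 : 0 < ρ) (hρ : ρ < 1 / 2) (hσ : σ ∈ Set.Ioo (0 : ℝ) 1) (hη : 0 < η)
    (hK : 0 ≤ K) (hK' : 0 ≤ K')
    (hcoer : ∀ k, η * ‖d k‖ ^ 2 ≤ inner ℝ (d k) (H k (d k))) (hHR : ∀ k, ‖H k‖ ≤ R)
    (hdesc : ∀ k, inner ℝ (gradient Φ (u k)) (d k) ≤ -inner ℝ (d k) (H k (d k)))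
    (harm : ∀ k, IsGreatest {s : ℝ | (∃ i : ℕ, s = σ ^ i) ∧
      Φ (u k + s • d k) ≤ Φ (u k) - ρ * s * inner ℝ (d k) (H k (d k))} (t k))
    (hstep : ∀ k, u (k + 1) = u k + t k • d k) (hbdd : Bornology.IsBounded (Set.range u))
    (hfeas : ∀ k i, inner ℝ (a i) (u k) ≤ b i)
    (hmult : ∀ k, IsMultiplier a b (u k + d k) (lam k))
    (hstat : ∀ k, ‖d k‖ ≤ 1 →
      ‖gradient Φ (u k) + H k (d k) + ∑ i, lam k i • a i‖ ≤ K * ‖d k‖ ^ 2)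
    (hacc : MapClusterPt x atTop u) {e : ι → V}
    (he : ∀ i j, inner ℝ (a i) x = b i → inner ℝ (a j) x = b j →
      inner ℝ (a i) (e j) = if i = j then (1 : ℝ) else 0)
    (hSSOS : ∀ ν, IsMultiplier a b x ν → gradient Φ x + ∑ i, ν i • a i = 0 →
      ∀ z, z ≠ 0 → (∀ i, 0 < ν i → inner ℝ (a i) z = 0) →
        0 < inner ℝ z (fderiv ℝ (gradient Φ) x z))
    {A : ℕ → Set ι} {T : Set ι}
    (hA : ∀ k, ∀ i ∈ A k, i ∈ T ∧ inner ℝ (a i) (u k + d k) = b i)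
    (hE : ∀ᶠ k in atTop, ∀ z, (∀ i ∈ A k, inner ℝ (a i) z = 0) →
      |inner ℝ (H k (d k) - fderiv ℝ (gradient Φ) (u k) (d k)) z| ≤ K' * ‖d k‖ ^ 2 * ‖z‖)
    (hSC : ∀ ν, IsMultiplier a b x ν → gradient Φ x + ∑ i, ν i • a i = 0 →
      ∀ i ∈ T, inner ℝ (a i) x = b i → 0 < ν i) :
    Tendsto u atTop (𝓝 x) ∧ (fun k => u (k + 1) - x) =O[atTop] fun k => ‖u k - x‖ ^ 2 := by
  have hd : Tendsto d atTop (𝓝 0) := tendsto_direction_zero hΦ ⟨hρ0, by linarith⟩ hσ hη hcoer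
    hdesc harm hstep hbdd
  have hdn : Tendsto (fun k => ‖d k‖) atTop (𝓝 0) := by simpa using hd.norm
  have hR : 0 ≤ R := (norm_nonneg _).trans (hHR 0)
  have hd1 : ∀ᶠ k in atTop, ‖d k‖ ≤ 1 := hdn.eventually_le_const one_pos
  have htone : ∀ k, 0 ≤ t k ∧ t k ≤ 1 := fun k => by
    obtain ⟨⟨i, hi⟩, -⟩ := (harm k).1
    rw [hi]
    exact ⟨pow_nonneg hσ.1.le i, pow_le_one₀ hσ.1.le hσ.2.le⟩
  have hcg : Continuous (gradient Φ) :=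
    (InnerProductSpace.toDual ℝ V).symm.continuous.comp (hΦ.continuous_fderiv (by norm_num))
  -- This filter takes the place of a subsequence converging to `x`.
  let l : Filter ℕ := atTop ⊓ comap u (𝓝 x)
  have hlNe : l.NeBot := by
    rw [← map_neBot_iff u, Filter.push_pull, inf_comm]
    exact hacc
  have hll : l ≤ atTop := inf_le_left
  have hul : Tendsto u l (𝓝 x) := tendsto_comap.mono_left inf_le_right
  have hdl : Tendsto d l (𝓝 0) := hd.mono_left hll
  have hwl : Tendsto (fun k => u k + d k) l (𝓝 x) := by simpa using hul.add hdl
  have hHd : Tendsto (fun k => H k (d k)) atTop (𝓝 0) := by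
    refine squeeze_zero_norm (fun k => (H k).le_of_opNorm_le (hHR k) (d k)) ?_
    simpa using hdn.const_mul R
  have hres : Tendsto (fun k => gradient Φ (u k) + H k (d k) + ∑ i, lam k i • a i)
      atTop (𝓝 0) := by
    refine squeeze_zero_norm' (hd1.mono fun k hk => hstat k hk) ?_
    simpa using (hdn.pow 2).const_mul K
  have hcomb : Tendsto (fun k => ∑ i, lam k i • a i) l (𝓝 (-gradient Φ x)) := by
    have h1 := ((hres.mono_left hll).sub (hHd.mono_left hll)).sub ((hcg.tendsto x).comp hul)
    rw [sub_zero, zero_sub] at h1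
    refine h1.congr fun k => ?_
    simp only [Function.comp]
    abel
  obtain ⟨-, ν, hν, hνsum, hlaml⟩ := exists_limit_multiplier he hwl hmult hcomb
  have hνstat : gradient Φ x + ∑ i, ν i • a i = 0 := by rw [hνsum]; abel
  have hΦ3 := hC3 hν.feasible
  obtain ⟨δ, hδ, L, hL, htay⟩ := exists_taylor hΦ3
  obtain ⟨c, hc, hcoerc⟩ := eventually_coercive hΦ3 hν hνstat (hSSOS ν hν hνstat)
  have hx : Tendsto u atTop (𝓝 x) := by
    -- The KKT residual at `u k + d k` is at most `(L + R + K) * ‖d k‖`: gradient change, model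
    -- Hessian, inexact stationarity. The summand 1 passes from `u k + d k` back to `u k`.
    refine tendsto_of_error_bound (C := (L + R + K) / c + 1) (d := d) (fun k => ?_) hd hlNe ?_
    · rw [hstep, add_sub_cancel_left, norm_smul, Real.norm_of_nonneg (htone k).1]
      exact mul_le_of_le_one_left (norm_nonneg _) (htone k).2
    · filter_upwards [hcoerc l _ lam hwl hmult hlaml, hul (Metric.ball_mem_nhds x hδ),
        hwl (Metric.ball_mem_nhds x hδ), hll hd1] with k hk hku hkw hkd
      have h1 := (htay _ hku _ hkw).1
      rw [add_sub_cancel_left] at h1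
      have h2 := (H k).le_of_opNorm_le (hHR k) (d k)
      have h3 : ‖gradient Φ (u k) + H k (d k) + ∑ i, lam k i • a i‖ ≤ K * ‖d k‖ := by
        refine (hstat k hkd).trans (mul_le_mul_of_nonneg_left ?_ hK)
        nlinarith [norm_nonneg (d k)]
      have h4 : ‖gradient Φ (u k + d k) + ∑ i, lam k i • a i‖ ≤ (L + R + K) * ‖d k‖ := by
        have h5 : gradient Φ (u k + d k) + ∑ i, lam k i • a i =
            (gradient Φ (u k + d k) - gradient Φ (u k)) - H k (d k)
              + (gradient Φ (u k) + H k (d k) + ∑ i, lam k i • a i) := by abel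
        rw [h5]
        refine (norm_add_le _ _).trans ?_
        have := norm_sub_le (gradient Φ (u k + d k) - gradient Φ (u k)) (H k (d k))
        linarith
      have h5 := hk.trans ((real_inner_le_norm _ _).trans
        (mul_le_mul_of_nonneg_right h4 (norm_nonneg _)))
      have h6 : ‖u k + d k - x‖ ≤ (L + R + K) / c * ‖d k‖ := by
        rw [div_mul_eq_mul_div, le_div_iff₀ hc]
        rcases (norm_nonneg (u k + d k - x)).eq_or_lt with h0 | h0
        · rw [← h0]; simp; positivity
        · nlinarith
      calc ‖u k - x‖ = ‖(u k + d k - x) - d k‖ := by congr 1; abel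
        _ ≤ ‖u k + d k - x‖ + ‖d k‖ := norm_sub_le _ _
        _ ≤ _ := by linarith
  refine ⟨hx, ?_⟩
  -- After convergence the localized filter is `atTop`, and all limits along it hold for the full
  -- sequence.
  have hl : l = atTop := inf_eq_left.2 (tendsto_iff_comap.1 hx)
  rw [hl] at hwl hlaml hcomb
  obtain ⟨hact, -⟩ := exists_limit_multiplier he hwl hmult hcomb
  have hAx : ∀ᶠ k in atTop, ∀ i ∈ A k, inner ℝ (a i) x = b i :=
    hact.mono fun k hk i hi => hk i (hA k i hi).2
  have hfast : ∀ᶠ k in atTop, ‖u k + d k - x‖ ≤ (L + K' + K) / c * ‖d k‖ ^ 2 := by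
    filter_upwards [hcoerc atTop _ lam hwl hmult hlaml, hx (Metric.ball_mem_nhds x hδ),
      hwl (Metric.ball_mem_nhds x hδ), hd1, hE, hAx] with k hk hku hkw hkd hkE hkA
    obtain ⟨z, hz⟩ : ∃ z, z = u k + d k - x := ⟨_, rfl⟩
    rw [← hz] at hk ⊢
    have h1 := (htay _ hku _ hkw).2.1
    rw [add_sub_cancel_left] at h1
    -- The constraints in `A k` are tight at `u k + d k` and at `x`, so the Hessian error is only
    -- needed against a vector of their null space.
    have h2 := hkE z fun i hi => by
      rw [hz, inner_sub_right, (hA k i hi).2, hkA i hi, sub_self]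
    have h3 := (real_inner_le_norm _ z).trans (mul_le_mul_of_nonneg_right h1 (norm_nonneg z))
    have h4 := (real_inner_le_norm _ z).trans
      (mul_le_mul_of_nonneg_right (hstat k hkd) (norm_nonneg z))
    have h5 : gradient Φ (u k + d k) + ∑ i, lam k i • a i =
        (gradient Φ (u k + d k) - gradient Φ (u k) - fderiv ℝ (gradient Φ) (u k) (d k))
          - (H k (d k) - fderiv ℝ (gradient Φ) (u k) (d k))
          + (gradient Φ (u k) + H k (d k) + ∑ i, lam k i • a i) := by abel
    rw [h5, inner_add_left, inner_sub_left] at hk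
    have h6 := neg_abs_le
      (inner ℝ (H k (d k) - fderiv ℝ (gradient Φ) (u k) (d k)) z)
    rw [div_mul_eq_mul_div, le_div_iff₀ hc]
    rcases (norm_nonneg z).eq_or_lt with h0 | h0
    · rw [← h0]; simp; positivity
    · refine le_of_mul_le_mul_right ?_ h0
      linarith
  have hfull : ∀ᶠ k in atTop, t k = 1 := by
    have hsm : ∀ᶠ k in atTop, (K + K' + L) * ‖d k‖ ≤ (1 / 2 - ρ) * η := by
      have h1 := hdn.const_mul (K + K' + L)
      rw [mul_zero] at h1
      exact h1.eventually_le_const (mul_pos (by linarith) hη)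
    -- The multipliers tend to positive limits while the left side tends to zero.
    have hlow : ∀ᶠ k in atTop, ∀ i, i ∈ T → inner ℝ (a i) x = b i →
        (K' + R + 2 * L) * ‖d k‖ * ‖e i‖ ≤ lam k i := by
      rw [eventually_all]
      intro i
      by_cases h : i ∈ T ∧ inner ℝ (a i) x = b i
      · have h1 : Tendsto (fun k => (K' + R + 2 * L) * ‖d k‖ * ‖e i‖) atTop (𝓝 0) := by
          simpa using (hdn.const_mul (K' + R + 2 * L)).mul_const ‖e i‖
        exact (h1.eventually_lt (hlaml i) (hSC ν hν hνstat i h.1 h.2)).mono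
          fun k hk _ _ => hk.le
      · exact Eventually.of_forall fun _ h1 h2 => absurd ⟨h1, h2⟩ h
    filter_upwards [hx (Metric.ball_mem_nhds x hδ), hwl (Metric.ball_mem_nhds x hδ), hd1, hE, hAx,
      hsm, hlow] with k hku hkw hkd hkE hkA hks hklow
    obtain ⟨-, h2, h3⟩ := htay _ hku _ hkw
    have h1 := (htay _ hku _ hkw).1
    rw [add_sub_cancel_left] at h1 h2 h3
    have hQ : ‖fderiv ℝ (gradient Φ) (u k) (d k)‖ ≤ 2 * L * ‖d k‖ := by
      have h4 : fderiv ℝ (gradient Φ) (u k) (d k) = (gradient Φ (u k + d k) - gradient Φ (u k))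
          - (gradient Φ (u k + d k) - gradient Φ (u k)
            - fderiv ℝ (gradient Φ) (u k) (d k)) := by abel
      have h5 : L * ‖d k‖ ^ 2 ≤ L * ‖d k‖ :=
        mul_le_mul_of_nonneg_left (by nlinarith [norm_nonneg (d k)]) hL
      rw [h4]
      refine (norm_sub_le _ _).trans ?_
      linarith
    have hdecr := full_step_decrease he hL hK' (hcoer k) (hHR k) (hmult k) (hfeas k)
      (hstat k hkd) (fun i hi => ⟨(hA k i hi).2, hkA i hi⟩) hkE hQ hkd h3
      (fun i hi => hklow i (hA k i hi).1 (hkA i hi)) hks hρ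
    refine le_antisymm (htone k).2 ((harm k).2 ⟨⟨0, by simp⟩, ?_⟩)
    simpa using hdecr
  -- The factor 4 is the square of the constant in `‖d k‖ ≤ 2 * ‖u k - x‖`.
  refine IsBigO.of_bound ((L + K' + K) / c * 4) ?_
  have hC0 : 0 ≤ (L + K' + K) / c := by positivity
  have hhalf : ∀ᶠ k in atTop, (L + K' + K) / c * ‖d k‖ ≤ 1 / 2 := by
    have h1 := hdn.const_mul ((L + K' + K) / c)
    rw [mul_zero] at h1
    exact h1.eventually_le_const one_half_pos
  filter_upwards [hfast, hfull, hhalf] with k hk hkt hkh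
  have h1 : ‖d k‖ ≤ 2 * ‖u k - x‖ := by
    have h2 : ‖d k‖ ≤ ‖u k + d k - x‖ + ‖u k - x‖ := by
      calc ‖d k‖ = ‖(u k + d k - x) - (u k - x)‖ := by congr 1; abel
        _ ≤ _ := norm_sub_le _ _
    have h3 := mul_le_mul_of_nonneg_right hkh (norm_nonneg (d k))
    nlinarith
  rw [hstep, hkt, one_smul, Real.norm_of_nonneg (sq_nonneg _)]
  have h2 : ‖d k‖ ^ 2 ≤ (2 * ‖u k - x‖) ^ 2 := pow_le_pow_left₀ (norm_nonneg _) h1 2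
  nlinarith [mul_le_mul_of_nonneg_left h2 hC0]

end PolyhedralSQP

/-! ### The two-block problem as a single polyhedral problem. -/

namespace CFDSQO

open PolyhedralSQP

variable {n₁ n₂ m l₁ l₂ : ℕ}

/-! ### Pairs of vectors -/

/-- The pair with the blocks `x` and `y`. -/
def pair (x : Fin n₁ → ℝ) (y : Fin n₂ → ℝ) : Pair n₁ n₂ := WithLp.toLp 2 (Sum.elim x y)

@[simp] lemma xp_add (u v : Pair n₁ n₂) : xp (u + v) = xp u + xp v := rfl
@[simp] lemma yp_add (u v : Pair n₁ n₂) : yp (u + v) = yp u + yp v := rfl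
@[simp] lemma xp_sub (u v : Pair n₁ n₂) : xp (u - v) = xp u - xp v := rfl
@[simp] lemma yp_sub (u v : Pair n₁ n₂) : yp (u - v) = yp u - yp v := rfl
@[simp] lemma xp_smul (c : ℝ) (u : Pair n₁ n₂) : xp (c • u) = c • xp u := rfl
@[simp] lemma yp_smul (c : ℝ) (u : Pair n₁ n₂) : yp (c • u) = c • yp u := rfl

/-- The `x`-block as a continuous linear map. -/
def xpL : Pair n₁ n₂ →L[ℝ] Vec (Fin n₁) :=
  LinearMap.toContinuousLinearMap { toFun := xp, map_add' := xp_add, map_smul' := xp_smul }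

/-- The `y`-block as a continuous linear map. -/
def ypL : Pair n₁ n₂ →L[ℝ] Vec (Fin n₂) :=
  LinearMap.toContinuousLinearMap { toFun := yp, map_add' := yp_add, map_smul' := yp_smul }

lemma inner_pair (x : Fin n₁ → ℝ) (y : Fin n₂ → ℝ) (u : Pair n₁ n₂) :
    inner ℝ (pair x y) u = x ⬝ᵥ (xp u).ofLp + y ⬝ᵥ (yp u).ofLp := by
  simp [pair, PiLp.inner_apply, xp, yp, dotProduct, mul_comm]

lemma inner_vec {ι : Type} [Fintype ι] (x y : Vec ι) : inner ℝ x y = x.ofLp ⬝ᵥ y.ofLp := by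
  simp [PiLp.inner_apply, dotProduct, mul_comm]

lemma pair_add (x x' : Fin n₁ → ℝ) (y y' : Fin n₂ → ℝ) :
    pair x y + pair x' y' = pair (x + x') (y + y') := by
  ext i; rcases i with i | i <;> simp [pair]

lemma pair_zero : pair (0 : Fin n₁ → ℝ) (0 : Fin n₂ → ℝ) = 0 := by
  ext i; rcases i with i | i <;> simp [pair]

lemma sum_smul_pair {q : ℕ} (c : Fin q → ℝ) (G : Matrix (Fin q) (Fin n₁) ℝ)
    (K : Matrix (Fin q) (Fin n₂) ℝ) :
    ∑ i, c i • pair (G i) (K i) = pair (G.transpose.mulVec c) (K.transpose.mulVec c) := by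
  ext i
  rcases i with i | i <;>
    simp [pair, Matrix.mulVec, dotProduct, mul_comm, WithLp.ofLp_sum, Finset.sum_apply]

/-! ### One-sided bounds with values in the extended reals -/

section Bounds

variable {W : Type*} [NormedAddCommGroup W] [InnerProductSpace ℝ W]

open Classical in
/-- Normal of the constraint `lo ≤ ⟪r, u⟫`; zero if the bound is infinite. -/
def lowerNormal (lo : EReal) (r : W) : W := if lo = ⊥ then 0 else -r

open Classical in
/-- Right-hand side of the constraint `lo ≤ ⟪r, u⟫`. -/
def lowerBound (lo : EReal) : ℝ := if lo = ⊥ then 1 else -lo.toReal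

open Classical in
/-- Normal of the constraint `⟪r, u⟫ ≤ hi`; zero if the bound is infinite. -/
def upperNormal (hi : EReal) (r : W) : W := if hi = ⊤ then 0 else r

open Classical in
/-- Right-hand side of the constraint `⟪r, u⟫ ≤ hi`. -/
def upperBound (hi : EReal) : ℝ := if hi = ⊤ then 1 else hi.toReal

/-- An infinite bound is encoded as `⟪0, u⟫ ≤ 1`, which always holds and is never tight; all
constraints thus become real ones over a fixed index type. -/
lemma inner_lowerNormal_le {lo : EReal} (hlo : lo ≠ ⊤) (r u : W) :
    inner ℝ (lowerNormal lo r) u ≤ lowerBound lo ↔ lo ≤ ((inner ℝ r u : ℝ) : EReal) := by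
  induction lo with
  | bot => simp [lowerNormal, lowerBound]
  | top => exact absurd rfl hlo
  | coe c => simp [lowerNormal, lowerBound]

lemma inner_lowerNormal_eq {lo : EReal} (hlo : lo ≠ ⊤) (r u : W) :
    inner ℝ (lowerNormal lo r) u = lowerBound lo ↔ lo = ((inner ℝ r u : ℝ) : EReal) := by
  induction lo with
  | bot => simp [lowerNormal, lowerBound]
  | top => exact absurd rfl hlo
  | coe c => simp [lowerNormal, lowerBound, eq_comm]

lemma inner_upperNormal_le {hi : EReal} (hhi : hi ≠ ⊥) (r u : W) :
    inner ℝ (upperNormal hi r) u ≤ upperBound hi ↔ ((inner ℝ r u : ℝ) : EReal) ≤ hi := by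
  induction hi with
  | bot => exact absurd rfl hhi
  | top => simp [upperNormal, upperBound]
  | coe c => simp [upperNormal, upperBound]

lemma inner_upperNormal_eq {hi : EReal} (hhi : hi ≠ ⊥) (r u : W) :
    inner ℝ (upperNormal hi r) u = upperBound hi ↔ hi = ((inner ℝ r u : ℝ) : EReal) := by
  induction hi with
  | bot => exact absurd rfl hhi
  | top => simp [upperNormal, upperBound]
  | coe c => simp [upperNormal, upperBound, eq_comm]

/-- A nonzero multiplier forces a finite bound, so the zero normal of an infinite one does not
affect stationarity. -/
lemma smul_lowerNormal {lo : EReal} {c α : ℝ} (h : α = 0 ∨ lo = (c : EReal)) (r : W) :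
    α • lowerNormal lo r = (-α) • r := by
  rcases h with h | h
  · simp [h]
  · simp [lowerNormal, h]

lemma smul_upperNormal {hi : EReal} {c γ : ℝ} (h : γ = 0 ∨ hi = (c : EReal)) (r : W) :
    γ • upperNormal hi r = γ • r := by
  rcases h with h | h
  · simp [h]
  · simp [upperNormal, h]

lemma lowerNormal_of_eq {W : Type*} [NormedAddCommGroup W] {lo : EReal} {c : ℝ} (h : lo = (c : EReal))
    (r : W) : lowerNormal lo r = -r := by simp [lowerNormal, h]

lemma upperNormal_of_eq {W : Type*} [NormedAddCommGroup W] {hi : EReal} {c : ℝ} (h : hi = (c : EReal))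
    (r : W) : upperNormal hi r = r := by simp [upperNormal, h]

end Bounds

/-! ### The feasible set as a polyhedron -/

/-- Indices of all one-sided constraints: coupling, lower and upper on `x`, lower and upper
on `y`. -/
abbrev Idx (m l₁ l₂ : ℕ) := Fin m ⊕ ((Fin l₁ ⊕ Fin l₁) ⊕ (Fin l₂ ⊕ Fin l₂))

namespace Problem

variable (P : Problem n₁ n₂ m l₁ l₂)

/-- Normals of the one-sided constraints. -/
def normal : Idx m l₁ l₂ → Pair n₁ n₂
  | .inl i => pair (P.E i) (P.F i)
  | .inr (.inl (.inl i)) => lowerNormal (P.l i) (pair (P.C i) 0)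
  | .inr (.inl (.inr i)) => upperNormal (P.v i) (pair (P.C i) 0)
  | .inr (.inr (.inl j)) => lowerNormal (P.s j) (pair 0 (P.D j))
  | .inr (.inr (.inr j)) => upperNormal (P.r j) (pair 0 (P.D j))

/-- Right-hand sides of the one-sided constraints. -/
def bound : Idx m l₁ l₂ → ℝ
  | .inl i => P.d i
  | .inr (.inl (.inl i)) => lowerBound (P.l i)
  | .inr (.inl (.inr i)) => upperBound (P.v i)
  | .inr (.inr (.inl j)) => lowerBound (P.s j)
  | .inr (.inr (.inr j)) => upperBound (P.r j)

lemma l_ne_top (i : Fin l₁) : P.l i ≠ ⊤ := (P.l_lt_v i).ne_top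
lemma v_ne_bot (i : Fin l₁) : P.v i ≠ ⊥ := (P.l_lt_v i).ne_bot
lemma s_ne_top (j : Fin l₂) : P.s j ≠ ⊤ := (P.s_lt_r j).ne_top
lemma r_ne_bot (j : Fin l₂) : P.r j ≠ ⊥ := (P.s_lt_r j).ne_bot

lemma inner_coupling (i : Fin m) (u : Pair n₁ n₂) :
    inner ℝ (pair (P.E i) (P.F i)) u = P.h (xp u) (yp u) i + P.d i := by
  rw [inner_pair]
  simp [h, Matrix.mulVec]

lemma inner_rowX (i : Fin l₁) (u : Pair n₁ n₂) :
    inner ℝ (pair (P.C i) 0) u = P.C.mulVec (xp u).ofLp i := by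
  rw [inner_pair]
  simp [Matrix.mulVec]

lemma inner_rowY (j : Fin l₂) (u : Pair n₁ n₂) :
    inner ℝ (pair 0 (P.D j)) u = P.D.mulVec (yp u).ofLp j := by
  rw [inner_pair]
  simp [Matrix.mulVec]

lemma active_inl (i : Fin m) (u : Pair n₁ n₂) :
    inner ℝ (P.normal (.inl i)) u = P.bound (.inl i) ↔ P.h (xp u) (yp u) i = 0 := by
  simp only [normal, bound, inner_coupling, add_eq_right]

lemma active_lx (i : Fin l₁) (u : Pair n₁ n₂) :
    inner ℝ (P.normal (.inr (.inl (.inl i)))) u = P.bound (.inr (.inl (.inl i))) ↔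
      P.l i = ((P.C.mulVec (xp u).ofLp i : ℝ) : EReal) := by
  rw [← inner_rowX]; exact inner_lowerNormal_eq (P.l_ne_top i) _ _

lemma active_vx (i : Fin l₁) (u : Pair n₁ n₂) :
    inner ℝ (P.normal (.inr (.inl (.inr i)))) u = P.bound (.inr (.inl (.inr i))) ↔
      P.v i = ((P.C.mulVec (xp u).ofLp i : ℝ) : EReal) := by
  rw [← inner_rowX]; exact inner_upperNormal_eq (P.v_ne_bot i) _ _

lemma active_sy (j : Fin l₂) (u : Pair n₁ n₂) :
    inner ℝ (P.normal (.inr (.inr (.inl j)))) u = P.bound (.inr (.inr (.inl j))) ↔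
      P.s j = ((P.D.mulVec (yp u).ofLp j : ℝ) : EReal) := by
  rw [← inner_rowY]; exact inner_lowerNormal_eq (P.s_ne_top j) _ _

lemma active_ry (j : Fin l₂) (u : Pair n₁ n₂) :
    inner ℝ (P.normal (.inr (.inr (.inr j)))) u = P.bound (.inr (.inr (.inr j))) ↔
      P.r j = ((P.D.mulVec (yp u).ofLp j : ℝ) : EReal) := by
  rw [← inner_rowY]; exact inner_upperNormal_eq (P.r_ne_bot j) _ _

lemma mem_feasible_iff (u : Pair n₁ n₂) :
    u ∈ P.feasible ↔ ∀ i, inner ℝ (P.normal i) u ≤ P.bound i := by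
  simp only [Sum.forall, normal, bound, inner_coupling, add_le_iff_nonpos_left,
    inner_lowerNormal_le (P.l_ne_top _), inner_upperNormal_le (P.v_ne_bot _),
    inner_lowerNormal_le (P.s_ne_top _), inner_upperNormal_le (P.r_ne_bot _), inner_rowX,
    inner_rowY, feasible, InBox, Set.mem_ofPred_eq, forall_and]

/-- A family of multipliers as one vector. -/
def _root_.CFDSQO.Mult.toVec (Λ : Mult m l₁ l₂) : Idx m l₁ l₂ → ℝ :=
  Sum.elim Λ.μ.ofLp (Sum.elim (Sum.elim Λ.αx Λ.γx) (Sum.elim Λ.αy Λ.γy))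

/-- The family of multipliers given by a vector. -/
def _root_.CFDSQO.Mult.ofVec (ν : Idx m l₁ l₂ → ℝ) : Mult m l₁ l₂ where
  μ := WithLp.toLp 2 fun i => ν (.inl i)
  αx := fun i => ν (.inr (.inl (.inl i)))
  γx := fun i => ν (.inr (.inl (.inr i)))
  αy := fun j => ν (.inr (.inr (.inl j)))
  γy := fun j => ν (.inr (.inr (.inr j)))

lemma _root_.CFDSQO.Mult.toVec_ofVec (ν : Idx m l₁ l₂ → ℝ) : (Mult.ofVec ν).toVec = ν := by
  funext i
  rcases i with i | (i | i) | (i | i) <;> rfl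

lemma isMultiplier_iff (w : Pair n₁ n₂) (Λ : Mult m l₁ l₂) :
    IsMultiplier P.normal P.bound w Λ.toVec ↔
      Compl Λ.μ.ofLp (-P.h (xp w) (yp w)) ∧ BoxCompl P.C P.l P.v (xp w) Λ.αx Λ.γx ∧
        BoxCompl P.D P.s P.r (yp w) Λ.αy Λ.γy := by
  constructor
  · rintro ⟨hf, hn, hc⟩
    obtain ⟨h1, h2, h3⟩ := (P.mem_feasible_iff w).2 hf
    refine ⟨fun i => ⟨hn (.inl i), by simpa using h1 i, ?_⟩,
      ⟨h2, fun i => ⟨⟨hn (.inr (.inl (.inl i))), ?_⟩, ⟨hn (.inr (.inl (.inr i))), ?_⟩⟩⟩, ⟨h3, fun j => ⟨⟨hn (.inr (.inr (.inl j))), ?_⟩,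
      ⟨hn (.inr (.inr (.inr j))), ?_⟩⟩⟩⟩
    · by_cases h : Λ.μ.ofLp i = 0
      · simp [h]
      · simp [(P.active_inl i w).1 (hc (.inl i) h)]
    · exact or_iff_not_imp_left.2 fun h => (P.active_lx i w).1 (hc (.inr (.inl (.inl i))) h)
    · exact or_iff_not_imp_left.2 fun h => (P.active_vx i w).1 (hc (.inr (.inl (.inr i))) h)
    · exact or_iff_not_imp_left.2 fun h => (P.active_sy j w).1 (hc (.inr (.inr (.inl j))) h)
    · exact or_iff_not_imp_left.2 fun h => (P.active_ry j w).1 (hc (.inr (.inr (.inr j))) h)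
  · rintro ⟨h1, ⟨h2, h3⟩, ⟨h4, h5⟩⟩
    refine ⟨(P.mem_feasible_iff w).1 ⟨fun i => by simpa using (h1 i).2.1, h2, h4⟩, ?_, ?_⟩
    · rintro (i | (i | i) | (i | i))
      exacts [(h1 i).1, (h3 i).1.1, (h3 i).2.1, (h5 i).1.1, (h5 i).2.1]
    · rintro (i | (i | i) | (i | i)) h
      · refine (P.active_inl i w).2 ?_
        simpa using (mul_eq_zero.1 (h1 i).2.2).resolve_left h
      · exact (P.active_lx i w).2 ((h3 i).1.2.resolve_left h)
      · exact (P.active_vx i w).2 ((h3 i).2.2.resolve_left h)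
      · exact (P.active_sy i w).2 ((h5 i).1.2.resolve_left h)
      · exact (P.active_ry i w).2 ((h5 i).2.2.resolve_left h)

lemma sum_normal {x : Vec (Fin n₁)} {y : Vec (Fin n₂)} (Λ : Mult m l₁ l₂)
    (hx : BoxCompl P.C P.l P.v x Λ.αx Λ.γx) (hy : BoxCompl P.D P.s P.r y Λ.αy Λ.γy) :
    ∑ i, Λ.toVec i • P.normal i =
      pair (P.E.transpose.mulVec Λ.μ.ofLp + P.C.transpose.mulVec (Λ.γx - Λ.αx))
        (P.F.transpose.mulVec Λ.μ.ofLp + P.D.transpose.mulVec (Λ.γy - Λ.αy)) := by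
  have h1 : ∑ i, Λ.αx i • lowerNormal (P.l i) (pair (P.C i) (0 : Fin n₂ → ℝ)) +
      ∑ i, Λ.γx i • upperNormal (P.v i) (pair (P.C i) (0 : Fin n₂ → ℝ)) =
      pair (P.C.transpose.mulVec (Λ.γx - Λ.αx)) 0 := by
    have h2 := sum_smul_pair (Λ.γx - Λ.αx) P.C (0 : Matrix (Fin l₁) (Fin n₂) ℝ)
    rw [Matrix.transpose_zero, Matrix.zero_mulVec] at h2
    rw [← h2, ← Finset.sum_add_distrib]
    refine Finset.sum_congr rfl fun i _ => ?_
    rw [smul_lowerNormal (hx.2 i).1.2, smul_upperNormal (hx.2 i).2.2, ← add_smul]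
    congr 1
    simp only [Pi.sub_apply]; ring
  have h3 : ∑ j, Λ.αy j • lowerNormal (P.s j) (pair (0 : Fin n₁ → ℝ) (P.D j)) +
      ∑ j, Λ.γy j • upperNormal (P.r j) (pair (0 : Fin n₁ → ℝ) (P.D j)) =
      pair 0 (P.D.transpose.mulVec (Λ.γy - Λ.αy)) := by
    have h2 := sum_smul_pair (Λ.γy - Λ.αy) (0 : Matrix (Fin l₂) (Fin n₁) ℝ) P.D
    rw [Matrix.transpose_zero, Matrix.zero_mulVec] at h2
    rw [← h2, ← Finset.sum_add_distrib]
    refine Finset.sum_congr rfl fun i _ => ?_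
    rw [smul_lowerNormal (hy.2 i).1.2, smul_upperNormal (hy.2 i).2.2, ← add_smul]
    congr 1
    simp only [Pi.sub_apply]; ring
  simp only [Fintype.sum_sum_type, Mult.toVec, Sum.elim_inl, Sum.elim_inr, normal]
  rw [h1, h3, sum_smul_pair, pair_add, pair_add]
  simp

/-! ### Objective -/

lemma contDiff_obj : ContDiff ℝ 1 P.obj :=
  (P.f_contDiff.comp xpL.contDiff).add (P.θ_contDiff.comp ypL.contDiff)

lemma gradient_obj (u : Pair n₁ n₂) :
    gradient P.obj u = pair (gradient P.f (xp u)).ofLp (gradient P.θ (yp u)).ofLp := by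
  refine ext_inner_right ℝ fun z => ?_
  have h1 : HasFDerivAt P.obj ((fderiv ℝ P.f (xp u)).comp xpL + (fderiv ℝ P.θ (yp u)).comp ypL) u :=
    ((P.f_contDiff.differentiable (by norm_num) _).hasFDerivAt.comp u xpL.hasFDerivAt).add
      ((P.θ_contDiff.differentiable (by norm_num) _).hasFDerivAt.comp u ypL.hasFDerivAt)
  rw [inner_gradient, h1.fderiv, inner_pair, ← inner_vec, ← inner_vec, inner_gradient,
    inner_gradient]
  rfl

/-- The limit multiplier is found by the abstract argument; this makes the second-order and strict
complementarity hypotheses available for it. -/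
lemma isKKT_ofVec {u : Pair n₁ n₂} {ν : Idx m l₁ l₂ → ℝ} (hν : IsMultiplier P.normal P.bound u ν)
    (hstat : gradient P.obj u + ∑ i, ν i • P.normal i = 0) : P.IsKKT u (Mult.ofVec ν) := by
  rw [← Mult.toVec_ofVec ν] at hν hstat
  obtain ⟨h1, h2, h3⟩ := (P.isMultiplier_iff u _).1 hν
  rw [P.sum_normal _ h2 h3, gradient_obj, pair_add] at hstat
  refine ⟨?_, ?_, h1, h2, h3⟩
  · funext i
    simpa [pair, add_assoc] using congrArg (fun z : Pair n₁ n₂ => z (Sum.inl i)) hstat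
  · funext i
    simpa [pair, add_assoc] using congrArg (fun z : Pair n₁ n₂ => z (Sum.inr i)) hstat

/-! ### Rows of the active constraints -/

/-- The rows of `rowMatrix`, as vectors. -/
def rowVec (S : Finset (Fin m)) (I : Finset (Fin l₁)) (J : Finset (Fin l₂)) :
    S ⊕ (I ⊕ J) → Pair n₁ n₂
  | .inl i => pair (P.E i) (P.F i)
  | .inr (.inl i) => pair (P.C i) 0
  | .inr (.inr j) => pair 0 (P.D j)

lemma rowMatrix_apply (S : Finset (Fin m)) (I : Finset (Fin l₁)) (J : Finset (Fin l₂))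
    (k : S ⊕ (I ⊕ J)) : P.rowMatrix S I J k = (P.rowVec S I J k).ofLp := by
  funext j
  rcases k with k | k | k <;> rcases j with j | j <;> rfl

lemma rowMatrix_mulVec (S : Finset (Fin m)) (I : Finset (Fin l₁)) (J : Finset (Fin l₂))
    (z : Pair n₁ n₂) (k : S ⊕ (I ⊕ J)) :
    (P.rowMatrix S I J).mulVec z.ofLp k = inner ℝ (P.rowVec S I J k) z := by
  rw [inner_vec, ← rowMatrix_apply]; rfl

lemma rowMatrix_mulVec_eq_zero_iff (S : Finset (Fin m)) (I : Finset (Fin l₁))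
    (J : Finset (Fin l₂)) (z : Pair n₁ n₂) :
    (P.rowMatrix S I J).mulVec z.ofLp = 0 ↔
      (∀ i ∈ S, inner ℝ (pair (P.E i) (P.F i)) z = 0) ∧
      (∀ i ∈ I, inner ℝ (pair (P.C i) 0) z = 0) ∧
      (∀ j ∈ J, inner ℝ (pair 0 (P.D j)) z = 0) := by
  simp only [funext_iff, rowMatrix_mulVec, Sum.forall, rowVec, Subtype.forall, Pi.zero_apply]

/-- Linearly independent vectors have a biorthogonal family. -/
lemma _root_.CFDSQO.exists_biorthogonal {κ ι : Type} [Fintype κ] [DecidableEq κ] [Fintype ι]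
    {v : κ → ι → ℝ} (hv : LinearIndependent ℝ v) :
    ∃ e : κ → Vec ι, ∀ k k', v k ⬝ᵥ (e k').ofLp = if k = k' then 1 else 0 := by
  classical
  -- The coordinates of a left inverse of the linear combination map are the dual functionals.
  obtain ⟨g, hg⟩ := (Fintype.linearCombination ℝ v).exists_leftInverse_of_injective
    (LinearMap.ker_eq_bot.2 hv.fintypeLinearCombination_injective)
  refine ⟨fun k' => WithLp.toLp 2 fun j => g (Pi.single j 1) k', fun k k' => ?_⟩
  have h1 : g (v k) = Pi.single k 1 := by
    have := LinearMap.congr_fun hg (Pi.single k 1)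
    simpa [Fintype.linearCombination_apply_single] using this
  have h2 : v k ⬝ᵥ (fun j => g (Pi.single j 1) k') = g (v k) k' := by
    conv_rhs => rw [← Finset.univ_sum_single (v k)]
    rw [map_sum, Finset.sum_apply]
    refine Finset.sum_congr rfl fun j _ => ?_
    have : (Pi.single j (v k j) : ι → ℝ) = v k j • Pi.single j 1 := by
      rw [← Pi.single_smul, smul_eq_mul, mul_one]
    rw [this, map_smul, Pi.smul_apply, smul_eq_mul]
  rw [show (WithLp.toLp 2 fun j => g (Pi.single j 1) k').ofLp = fun j => g (Pi.single j 1) k'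
    from rfl, h2, h1, Pi.single_apply]
  simp [eq_comm]

/-- The two-sided constraint to which a one-sided constraint belongs. -/
def _root_.CFDSQO.Idx.parent : Idx m l₁ l₂ → Fin m ⊕ (Fin l₁ ⊕ Fin l₂)
  | .inl i => .inl i
  | .inr (.inl (.inl i)) => .inr (.inl i)
  | .inr (.inl (.inr i)) => .inr (.inl i)
  | .inr (.inr (.inl j)) => .inr (.inr j)
  | .inr (.inr (.inr j)) => .inr (.inr j)

/-- Lower and upper bounds of one row differ and cannot both be tight. Hence active one-sided
constraints inject into the rows of the active matrix. -/
lemma eq_of_parent_eq {u : Pair n₁ n₂} {i j : Idx m l₁ l₂}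
    (hi : inner ℝ (P.normal i) u = P.bound i) (hj : inner ℝ (P.normal j) u = P.bound j)
    (hij : i.parent = j.parent) : i = j := by
  rcases i with i | (i | i) | (i | i) <;> rcases j with j | (j | j) | (j | j) <;>
    simp only [Idx.parent, Sum.inl.injEq, Sum.inr.injEq, reduceCtorEq] at hij <;>
    subst hij <;> try rfl
  · exact absurd (((P.active_lx i u).1 hi).trans ((P.active_vx i u).1 hj).symm) (P.l_lt_v i).ne
  · exact absurd (((P.active_lx i u).1 hj).trans ((P.active_vx i u).1 hi).symm) (P.l_lt_v i).ne
  · exact absurd (((P.active_sy i u).1 hi).trans ((P.active_ry i u).1 hj).symm) (P.s_lt_r i).ne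
  · exact absurd (((P.active_sy i u).1 hj).trans ((P.active_ry i u).1 hi).symm) (P.s_lt_r i).ne

/-- The sign `c` is -1 for lower bounds; the form `c * c = 1` is what the diagonal of the
biorthogonality relation needs. -/
lemma exists_row_of_active {u : Pair n₁ n₂} {i : Idx m l₁ l₂}
    (hi : inner ℝ (P.normal i) u = P.bound i) :
    ∃ (k : P.activeS (xp u) (yp u) ⊕ (P.activeX (xp u) ⊕ P.activeY (yp u))) (c : ℝ), c * c = 1 ∧
      P.normal i = c • P.rowVec _ _ _ k ∧
      Sum.map Subtype.val (Sum.map Subtype.val Subtype.val) k = i.parent := by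
  rcases i with i | (i | i) | (i | i)
  · have h := (P.active_inl i u).1 hi
    exact ⟨.inl ⟨i, by simp [activeS, h]⟩, 1, by simp, by simp [normal, rowVec], rfl⟩
  · have h := (P.active_lx i u).1 hi
    exact ⟨.inr (.inl ⟨i, by simp [activeX, activeSet, h]⟩), -1, by simp,
      by simp [normal, rowVec, lowerNormal_of_eq h], rfl⟩
  · have h := (P.active_vx i u).1 hi
    exact ⟨.inr (.inl ⟨i, by simp [activeX, activeSet, h]⟩), 1, by simp,
      by simp [normal, rowVec, upperNormal_of_eq h], rfl⟩
  · have h := (P.active_sy i u).1 hi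
    exact ⟨.inr (.inr ⟨i, by simp [activeY, activeSet, h]⟩), -1, by simp,
      by simp [normal, rowVec, lowerNormal_of_eq h], rfl⟩
  · have h := (P.active_ry i u).1 hi
    exact ⟨.inr (.inr ⟨i, by simp [activeY, activeSet, h]⟩), 1, by simp,
      by simp [normal, rowVec, upperNormal_of_eq h], rfl⟩

lemma LICQ.exists_dual {P : Problem n₁ n₂ m l₁ l₂} {u : Pair n₁ n₂} (hL : P.LICQ u) :
    ∃ e : Idx m l₁ l₂ → Pair n₁ n₂, ∀ i j, inner ℝ (P.normal i) u = P.bound i →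
      inner ℝ (P.normal j) u = P.bound j →
      inner ℝ (P.normal i) (e j) = if i = j then (1 : ℝ) else 0 := by
  classical
  obtain ⟨e, he⟩ := exists_biorthogonal hL
  choose! k c hc hn hk using fun i : {i // inner ℝ (P.normal i) u = P.bound i} =>
    P.exists_row_of_active i.2
  refine ⟨fun j => if h : inner ℝ (P.normal j) u = P.bound j then c ⟨j, h⟩ • e (k ⟨j, h⟩) else 0,
    fun i j hi hj => ?_⟩
  simp only [hj, dif_pos]
  have h1 := he (k ⟨i, hi⟩) (k ⟨j, hj⟩)
  rw [Matrix.row, rowMatrix_apply, ← inner_vec] at h1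
  rw [hn ⟨i, hi⟩, real_inner_smul_left, real_inner_smul_right, h1]
  by_cases hij : i = j
  · subst hij
    simp [hc]
  · have : k ⟨i, hi⟩ ≠ k ⟨j, hj⟩ := fun h => hij (P.eq_of_parent_eq hi hj (by
      rw [← hk ⟨i, hi⟩, ← hk ⟨j, hj⟩, h]))
    simp [hij, this]

/-- Vectors orthogonal to the rows of `B` have the same inner product with `v` and with its
projection. -/
lemma inner_projMatrix (S : Finset (Fin m)) (I : Finset (Fin l₁)) (J : Finset (Fin l₂))
    (v z : Pair n₁ n₂) (hz : (P.rowMatrix S I J).mulVec z.ofLp = 0) :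
    inner ℝ (Matrix.toEuclideanCLM (𝕜 := ℝ) (P.projMatrix S I J) v) z = inner ℝ v z := by
  -- The outer transpose is moved onto `z` and annihilates it, so invertibility of `B Bᵀ` plays no
  -- role.
  rw [inner_vec, inner_vec, Matrix.ofLp_toEuclideanCLM, projMatrix, Matrix.sub_mulVec,
    Matrix.one_mulVec, sub_dotProduct, Matrix.mul_assoc, ← Matrix.mulVec_mulVec,
    Matrix.mulVec_transpose, ← Matrix.dotProduct_mulVec, hz, dotProduct_zero, sub_zero]

end Problem

end CFDSQO

namespace CFDSQO

open PolyhedralSQP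

variable {n₁ n₂ m l₁ l₂ : ℕ}

/-! ### Quadratic models -/

lemma sqNorm_smul {ι : Type} [Fintype ι] (H : Matrix ι ι ℝ) (c : ℝ) (z : Vec ι) :
    sqNorm H (c • z) = c ^ 2 * sqNorm H z := by
  simp only [sqNorm, WithLp.ofLp_smul, Matrix.mulVec_smul, dotProduct_smul, smul_dotProduct,
    smul_eq_mul]
  ring

/-- A minimizer of a quadratic model over a set that contains the segment from the base point is
reached along a descent direction. -/
lemma inner_le_neg_sqNorm {ι : Type} [Fintype ι] {g x w : Vec ι} {H : Matrix ι ι ℝ}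
    {S : Set (Vec ι)} (hseg : ∀ s ∈ Set.Icc (0 : ℝ) 1, x + s • (w - x) ∈ S)
    (hmin : IsMinOn (fun z => inner ℝ g (z - x) + 1 / 2 * sqNorm H (z - x)) S w) :
    inner ℝ g (w - x) ≤ -sqNorm H (w - x) := by
  set G := inner ℝ g (w - x)
  set N := sqNorm H (w - x)
  have h1 : ∀ s ∈ Set.Icc (0 : ℝ) 1, G + 1 / 2 * N ≤ s * G + 1 / 2 * (s ^ 2 * N) := fun s hs => by
    have := hmin (hseg s hs)
    simpa only [Set.mem_ofPred_eq, add_sub_cancel_left, real_inner_smul_right, sqNorm_smul]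
      using this
  by_contra! h
  have hpos : 0 < G + N := by linarith
  -- Comparing the model at `s` and at 1 gives `G + N ≤ (1 - s) / 2 * N`. With `1 - s` positive but
  -- at most `(G + N) / (|N| + 1)` this is impossible, whatever the sign of `N`.
  set s : ℝ := max 0 (1 - (G + N) / (|N| + 1)) with hs
  have hN : 0 < |N| + 1 := by positivity
  have hs1 : s < 1 := max_lt one_pos (by linarith [div_pos hpos hN])
  have h2 := h1 s ⟨le_max_left _ _, hs1.le⟩
  have h3 : 0 ≤ (1 - s) * -(G + N - (1 - s) / 2 * N) := by nlinarith
  have h4 : G + N ≤ (1 - s) / 2 * N := by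
    have := nonneg_of_mul_nonneg_right h3 (by linarith)
    linarith
  have h5 : 1 - s ≤ (G + N) / (|N| + 1) := by linarith [le_max_right 0 (1 - (G + N) / (|N| + 1))]
  have h6 : (1 - s) * (|N| + 1) ≤ G + N := (le_div_iff₀ hN).1 h5
  have h7 : (1 - s) / 2 * N ≤ (1 - s) / 2 * |N| :=
    mul_le_mul_of_nonneg_left (le_abs_self N) (by linarith)
  have h8 : 0 ≤ (1 - s) * |N| := mul_nonneg (by linarith) (abs_nonneg N)
  linarith

lemma InBox.segment {q n : ℕ} {G : Matrix (Fin q) (Fin n) ℝ} {lo hi : Fin q → EReal}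
    {z w : Vec (Fin n)} (hz : InBox G lo hi z) (hw : InBox G lo hi w) {s : ℝ}
    (hs : s ∈ Set.Icc (0 : ℝ) 1) : InBox G lo hi (z + s • (w - z)) := by
  intro i
  have h1 : G.mulVec (z + s • (w - z)).ofLp i =
      G.mulVec z.ofLp i + s * (G.mulVec w.ofLp i - G.mulVec z.ofLp i) := by
    simp [Matrix.mulVec_add, Matrix.mulVec_smul, Matrix.mulVec_sub]
  rw [h1]
  set c := G.mulVec z.ofLp i with hc
  set c' := G.mulVec w.ofLp i with hc'
  have hzi := hz i
  have hwi := hw i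
  rw [← hc] at hzi
  rw [← hc'] at hwi
  obtain ⟨hs0, hs1⟩ := hs
  -- The intermediate value lies between two real values, so no arithmetic with infinite bounds is
  -- needed.
  rcases le_total c c' with h | h
  · exact ⟨hzi.1.trans (EReal.coe_le_coe_iff.2 (by nlinarith)),
      le_trans (EReal.coe_le_coe_iff.2 (by nlinarith)) hwi.2⟩
  · exact ⟨hwi.1.trans (EReal.coe_le_coe_iff.2 (by nlinarith)),
      le_trans (EReal.coe_le_coe_iff.2 (by nlinarith)) hzi.2⟩

namespace Problem

variable {P : Problem n₁ n₂ m l₁ l₂}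

lemma segment_mem_feasible {u w : Pair n₁ n₂} (hu : u ∈ P.feasible) (hw : w ∈ P.feasible) {s : ℝ}
    (hs : s ∈ Set.Icc (0 : ℝ) 1) : u + s • (w - u) ∈ P.feasible := by
  rw [mem_feasible_iff] at *
  intro i
  have h1 := mul_le_mul_of_nonneg_left (hw i) hs.1
  have h2 := mul_le_mul_of_nonneg_left (hu i) (sub_nonneg.2 hs.2)
  rw [inner_add_right, real_inner_smul_right, inner_sub_right]
  linarith

/-- The coupling is affine without mixed terms, so the effects of separate block moves add. With
contraction one half, two split constraints combine to the joint one, and two tight ones to a tight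
one. -/
lemma h_add_h (x x' : Vec (Fin n₁)) (y y' : Vec (Fin n₂)) (i : Fin m) :
    P.h x' y' i = P.h x' y i + P.h x y' i - P.h x y i := by
  simp only [h, Pi.sub_apply, Pi.add_apply]; ring

variable {u w : Pair n₁ n₂} {Hx : Matrix (Fin n₁) (Fin n₁) ℝ} {Hy : Matrix (Fin n₂) (Fin n₂) ℝ}

lemma SolvesSplit.mem_feasible {Λ : SplitMult m l₁ l₂} (hw : P.SolvesSplit 1 u Hx Hy w Λ) :
    w ∈ P.feasible := by
  obtain ⟨⟨⟨h1, h2⟩, -⟩, ⟨⟨h3, h4⟩, -⟩, -⟩ := hw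
  refine ⟨fun i => ?_, h2, h4⟩
  rw [h_add_h (xp u) _ (yp u)]
  linarith [h1 i, h3 i]

lemma sqNorm_fromBlocks (z : Pair n₁ n₂) :
    sqNorm (Matrix.fromBlocks Hx 0 0 Hy) z = sqNorm Hx (xp z) + sqNorm Hy (yp z) := by
  have hz : z.ofLp = Sum.elim (xp z).ofLp (yp z).ofLp := by
    funext i; rcases i with i | i <;> rfl
  simp only [sqNorm]
  rw [hz, Matrix.fromBlocks_mulVec]
  simp [Function.comp_def, dotProduct, Fintype.sum_sum_type]

lemma toEuclideanCLM_fromBlocks (z : Pair n₁ n₂) :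
    Matrix.toEuclideanCLM (𝕜 := ℝ) (Matrix.fromBlocks Hx 0 0 Hy) z =
      pair (Hx.mulVec (xp z).ofLp) (Hy.mulVec (yp z).ofLp) := by
  have hz : z.ofLp = Sum.elim (xp z).ofLp (yp z).ofLp := by
    funext i; rcases i with i | i <;> rfl
  refine WithLp.ofLp_injective 2 ?_
  rw [Matrix.ofLp_toEuclideanCLM, hz, Matrix.fromBlocks_mulVec]
  simp [Function.comp_def, pair]

lemma inner_gradient_obj (z : Pair n₁ n₂) :
    inner ℝ (gradient P.obj u) z =
      inner ℝ (gradient P.f (xp u)) (xp z) + inner ℝ (gradient P.θ (yp u)) (yp z) := by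
  rw [gradient_obj, inner_pair, inner_vec, inner_vec]

lemma SolvesJoint.inner_le {Λ : Mult m l₁ l₂} (hu : u ∈ P.feasible)
    (hw : P.SolvesJoint u Hx Hy w Λ) :
    inner ℝ (gradient P.obj u) (w - u) ≤ -sqNorm (Matrix.fromBlocks Hx 0 0 Hy) (w - u) := by
  refine inner_le_neg_sqNorm (fun s hs => segment_mem_feasible hu hw.1.1 hs) ?_
  convert hw.1.2 using 2 with z
  rw [inner_gradient_obj, sqNorm_fromBlocks, qx, qy, xp_sub, yp_sub]
  ring

lemma SolvesSplit.inner_le {Λ : SplitMult m l₁ l₂} (hu : u ∈ P.feasible)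
    (hw : P.SolvesSplit 1 u Hx Hy w Λ) :
    inner ℝ (gradient P.obj u) (w - u) ≤ -sqNorm (Matrix.fromBlocks Hx 0 0 Hy) (w - u) := by
  obtain ⟨⟨⟨h1, h2⟩, h3⟩, ⟨⟨h4, h5⟩, h6⟩, -⟩ := hw
  obtain ⟨hu1, hu2, hu3⟩ := hu
  have hx : inner ℝ (gradient P.f (xp u)) (xp w - xp u) ≤ -sqNorm Hx (xp w - xp u) := by
    refine inner_le_neg_sqNorm (S := P.splitFeasX 1 u) (fun s hs => ⟨fun i => ?_, hu2.segment h2 hs⟩) h3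
    have h7 : P.h (xp u + s • (xp w - xp u)) (yp u) i =
        P.h (xp u) (yp u) i + s * (P.h (xp w) (yp u) i - P.h (xp u) (yp u) i) := by
      simp [h, Matrix.mulVec_add, Matrix.mulVec_smul, Matrix.mulVec_sub]; ring
    rw [h7]
    -- Since `h ≤ 0` gives `h ≤ h / 2`, the base point is feasible for the contracted problem, and
    -- so is the segment.
    have h8 := mul_le_mul_of_nonneg_left (h1 i) hs.1
    have h9 := mul_nonneg (sub_nonneg.2 hs.2) (neg_nonneg.2 (hu1 i))
    nlinarith
  have hy : inner ℝ (gradient P.θ (yp u)) (yp w - yp u) ≤ -sqNorm Hy (yp w - yp u) := by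
    refine inner_le_neg_sqNorm (S := P.splitFeasY 1 u) (fun s hs => ⟨fun i => ?_, hu3.segment h5 hs⟩) h6
    have h7 : P.h (xp u) (yp u + s • (yp w - yp u)) i =
        P.h (xp u) (yp u) i + s * (P.h (xp u) (yp w) i - P.h (xp u) (yp u) i) := by
      simp [h, Matrix.mulVec_add, Matrix.mulVec_smul, Matrix.mulVec_sub]; ring
    rw [h7]
    have h8 := mul_le_mul_of_nonneg_left (h4 i) hs.1
    have h9 := mul_nonneg (sub_nonneg.2 hs.2) (neg_nonneg.2 (hu1 i))
    nlinarith
  rw [inner_gradient_obj, sqNorm_fromBlocks, xp_sub, yp_sub]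
  linarith

lemma SolvesJoint.isMultiplier {Λ : Mult m l₁ l₂} (hw : P.SolvesJoint u Hx Hy w Λ) :
    IsMultiplier P.normal P.bound w Λ.toVec :=
  (P.isMultiplier_iff w Λ).2 hw.2.2.2

lemma SolvesJoint.stationary {Λ : Mult m l₁ l₂} (hw : P.SolvesJoint u Hx Hy w Λ) :
    gradient P.obj u + Matrix.toEuclideanCLM (𝕜 := ℝ) (Matrix.fromBlocks Hx 0 0 Hy) (w - u)
      + ∑ i, Λ.toVec i • P.normal i = 0 := by
  obtain ⟨-, h1, h2, -, h3, h4⟩ := hw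
  rw [P.sum_normal Λ h3 h4, gradient_obj, toEuclideanCLM_fromBlocks, pair_add, pair_add, xp_sub,
    yp_sub, ← add_assoc, ← add_assoc, h1, h2, pair_zero]

/-- The multipliers of the joint problem obtained from those of the split problems: the
componentwise minimum for the coupling constraint. -/
def _root_.CFDSQO.SplitMult.merge (Λ : SplitMult m l₁ l₂) : Mult m l₁ l₂ where
  μ := WithLp.toLp 2 fun i => min (Λ.μx i) (Λ.μy i)
  αx := Λ.αx
  γx := Λ.γx
  αy := Λ.αy
  γy := Λ.γy

/-- A positive minimum means that both split constraints are tight, and then the joint one is tight;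
this is why the minimum is used rather than either multiplier or an average. -/
lemma SolvesSplit.isMultiplier {Λ : SplitMult m l₁ l₂} (hw : P.SolvesSplit 1 u Hx Hy w Λ) :
    IsMultiplier P.normal P.bound w Λ.merge.toVec := by
  have hf := hw.mem_feasible
  obtain ⟨-, -, -, h1, h2, -, h3, h4⟩ := hw
  refine (P.isMultiplier_iff w _).2 ⟨fun i => ?_, h2, h4⟩
  obtain ⟨ha, hb, hc⟩ := h1 i
  obtain ⟨ha', hb', hc'⟩ := h3 i
  refine ⟨le_min ha ha', by simpa using hf.1 i, ?_⟩
  change min (Λ.μx.ofLp i) (Λ.μy.ofLp i) * _ = 0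
  rcases ha.eq_or_lt with h | h
  · rw [← h, min_eq_left ha', zero_mul]
  rcases ha'.eq_or_lt with h' | h'
  · rw [← h', min_eq_right ha, zero_mul]
  have h5 := (mul_eq_zero.1 hc).resolve_left h.ne'
  have h6 := (mul_eq_zero.1 hc').resolve_left h'.ne'
  simp only [Pi.sub_apply, Pi.smul_apply, smul_eq_mul] at h5 h6
  rw [Pi.neg_apply, h_add_h (xp u) _ (yp u)]
  rw [show P.h (xp w) (yp u) i + P.h (xp u) (yp w) i - P.h (xp u) (yp u) i = 0 by linarith]
  simp

/-- A constant that controls the effect of a discrepancy of the coupling multipliers. -/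
def couplingConst (P : Problem n₁ n₂ m l₁ l₂) : ℝ :=
  ∑ i, (‖(pair (P.E i) 0 : Pair n₁ n₂)‖ + ‖(pair 0 (P.F i) : Pair n₁ n₂)‖)

lemma couplingConst_nonneg : 0 ≤ P.couplingConst :=
  Finset.sum_nonneg fun _ _ => by positivity

/-- Both split systems are exactly stationary; the residual comes only from replacing each coupling
multiplier by the minimum. -/
lemma SolvesSplit.norm_stationary_le {Λ : SplitMult m l₁ l₂} (hw : P.SolvesSplit 1 u Hx Hy w Λ) :
    ‖gradient P.obj u + Matrix.toEuclideanCLM (𝕜 := ℝ) (Matrix.fromBlocks Hx 0 0 Hy) (w - u)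
      + ∑ i, Λ.merge.toVec i • P.normal i‖ ≤ P.couplingConst * ‖Λ.μx - Λ.μy‖ := by
  obtain ⟨-, -, h1, -, h2, h3, -, h4⟩ := hw
  set μ : Fin m → ℝ := fun i => min (Λ.μx i) (Λ.μy i) with hμ
  have hres : gradient P.obj u
      + Matrix.toEuclideanCLM (𝕜 := ℝ) (Matrix.fromBlocks Hx 0 0 Hy) (w - u)
      + ∑ i, Λ.merge.toVec i • P.normal i =
      ∑ i, ((μ i - Λ.μx i) • pair (P.E i) 0 + (μ i - Λ.μy i) • pair 0 (P.F i)) := by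
    have e1 := sum_smul_pair (μ - Λ.μx.ofLp) P.E (0 : Matrix (Fin m) (Fin n₂) ℝ)
    have e2 := sum_smul_pair (μ - Λ.μy.ofLp) (0 : Matrix (Fin m) (Fin n₁) ℝ) P.F
    rw [Matrix.transpose_zero, Matrix.zero_mulVec] at e1 e2
    simp only [Pi.sub_apply] at e1 e2
    rw [Finset.sum_add_distrib]
    refine Eq.trans ?_ (congrArg₂ (· + ·) e1 e2).symm
    rw [P.sum_normal Λ.merge h2 h4, gradient_obj, toEuclideanCLM_fromBlocks, pair_add, pair_add,
      pair_add, xp_sub, yp_sub, add_zero, zero_add]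
    congr 1
    · change _ + (P.E.transpose.mulVec μ + P.C.transpose.mulVec (Λ.γx - Λ.αx)) = _
      rw [Matrix.mulVec_sub _ μ, ← sub_eq_zero, ← h1]
      abel
    · change _ + (P.F.transpose.mulVec μ + P.D.transpose.mulVec (Λ.γy - Λ.αy)) = _
      rw [Matrix.mulVec_sub _ μ, ← sub_eq_zero, ← h3]
      abel
  rw [hres, couplingConst, Finset.sum_mul]
  refine (norm_sum_le _ _).trans (Finset.sum_le_sum fun i _ => ?_)
  have hi : |Λ.μx i - Λ.μy i| ≤ ‖Λ.μx - Λ.μy‖ := PiLp.norm_apply_le (Λ.μx - Λ.μy) i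
  have hx : |μ i - Λ.μx i| ≤ ‖Λ.μx - Λ.μy‖ := by
    refine le_trans ?_ hi
    rcases le_total (Λ.μx i) (Λ.μy i) with h | h
    · simp [hμ, h]
    · simp [hμ, h, abs_sub_comm]
  have hy : |μ i - Λ.μy i| ≤ ‖Λ.μx - Λ.μy‖ := by
    refine le_trans ?_ hi
    rcases le_total (Λ.μx i) (Λ.μy i) with h | h
    · simp [hμ, h]
    · simp [hμ, h]
  refine (norm_add_le _ _).trans ?_
  rw [norm_smul, norm_smul, Real.norm_eq_abs, Real.norm_eq_abs]
  have := mul_le_mul_of_nonneg_right hx (norm_nonneg (pair (P.E i) 0 : Pair n₁ n₂))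
  have := mul_le_mul_of_nonneg_right hy (norm_nonneg (pair 0 (P.F i) : Pair n₁ n₂))
  linarith

lemma ssos_ofVec {ν : Idx m l₁ l₂ → ℝ} (h : P.SSOS u (Mult.ofVec ν)) (z : Pair n₁ n₂) (hz : z ≠ 0)
    (hker : ∀ i, 0 < ν i → inner ℝ (P.normal i) z = 0) : 0 < inner ℝ z (hess P.obj u z) := by
  refine h z hz ((P.rowMatrix_mulVec_eq_zero_iff _ _ _ z).2 ⟨fun i hi => ?_, fun i hi => ?_,
    fun i hi => ?_⟩)
  · exact hker (.inl i) (Finset.mem_filter.1 hi).2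
  · rcases Finset.mem_union.1 hi with hi | hi <;> obtain ⟨h1, h2⟩ := Finset.mem_filter.1 hi
    · have h3 := hker (.inr (.inl (.inl i))) h2
      simpa [normal, lowerNormal_of_eq (Finset.mem_filter.1 h1).2] using h3
    · have h3 := hker (.inr (.inl (.inr i))) h2
      simpa [normal, upperNormal_of_eq (Finset.mem_filter.1 h1).2] using h3
  · rcases Finset.mem_union.1 hi with hi | hi <;> obtain ⟨h1, h2⟩ := Finset.mem_filter.1 hi
    · have h3 := hker (.inr (.inr (.inl i))) h2
      simpa [normal, lowerNormal_of_eq (Finset.mem_filter.1 h1).2] using h3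
    · have h3 := hker (.inr (.inr (.inr i))) h2
      simpa [normal, upperNormal_of_eq (Finset.mem_filter.1 h1).2] using h3

lemma strictCompl_ofVec {ν : Idx m l₁ l₂ → ℝ} (h : P.StrictCompl u (Mult.ofVec ν))
    (i : Idx m l₁ l₂) (hi : inner ℝ (P.normal i) u = P.bound i) : 0 < ν i := by
  obtain ⟨h1, h2, h3, h4, h5⟩ := h
  rcases i with i | (i | i) | (i | i)
  · exact h5 i (by simpa [activeS] using (P.active_inl i u).1 hi)
  · exact h1 i (by simpa [activeSet] using (P.active_lx i u).1 hi)
  · exact h2 i (by simpa [activeSet] using (P.active_vx i u).1 hi)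
  · exact h3 i (by simpa [activeSet] using (P.active_sy i u).1 hi)
  · exact h4 i (by simpa [activeSet] using (P.active_ry i u).1 hi)

lemma CThreeNearFeasible.contDiffAt (h : P.CThreeNearFeasible) (hu : u ∈ P.feasible) :
    ContDiffAt ℝ 3 P.obj u := by
  obtain ⟨V, hV, hFV, hf, hθ⟩ := h
  exact (hf.contDiffAt (hV.mem_nhds (hFV hu))).add (hθ.contDiffAt (hV.mem_nhds (hFV hu)))

end Problem

/-! ### Runs of the method -/

namespace Trace

variable (T : Trace n₁ n₂ m l₁ l₂)

open Classical in
/-- Multipliers of the joint problem at the subproblem solution of iteration `k`. -/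
def multiplier (p : Params) (k : ℕ) : Mult m l₁ l₂ :=
  if T.Accepted p k then (T.Λs k).merge else T.Λj k

variable {T}

lemma u_add_d (p : Params) (k : ℕ) : T.u k + T.d p k = T.ut p k := by simp [d]

/-- For `c = 1` split and joint steps start the line search at the same trial step. -/
lemma cmax_eq_one {p : Params} (hc : p.c = 1) (k : ℕ) : T.cmax p k = 1 := by
  rw [cmax, hc]; split_ifs <;> norm_num

namespace IsRun

variable {P : Problem n₁ n₂ m l₁ l₂} {p : Params} (hrun : T.IsRun P p) (hc : p.c = 1)

include hrun hc

lemma solvesSplit (k : ℕ) : P.SolvesSplit 1 (T.u k) (T.Hx k) (T.Hy k) (T.us k) (T.Λs k) :=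
  hc ▸ hrun.split k

lemma isMultiplier (k : ℕ) :
    IsMultiplier P.normal P.bound (T.u k + T.d p k) (T.multiplier p k).toVec := by
  rw [u_add_d]
  by_cases h : T.Accepted p k
  · simpa only [ut, multiplier, h, if_true] using (hrun.solvesSplit hc k).isMultiplier
  · simpa only [ut, multiplier, h, if_false] using (hrun.joint k h).isMultiplier

lemma ut_mem_feasible (k : ℕ) : T.ut p k ∈ P.feasible := by
  rw [← u_add_d]
  exact (P.mem_feasible_iff _).2 (hrun.isMultiplier hc k).feasible

lemma isGreatest (k : ℕ) : IsGreatest {s : ℝ | (∃ i : ℕ, s = p.σ ^ i) ∧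
    P.obj (T.u k + s • T.d p k) ≤ P.obj (T.u k) - p.ρ * s * sqNorm (T.Hu k) (T.d p k)} (T.t k) := by
  simpa only [cmax_eq_one hc, one_mul] using hrun.armijo k

lemma t_mem_Icc (k : ℕ) : T.t k ∈ Set.Icc (0 : ℝ) 1 := by
  obtain ⟨⟨i, hi⟩, -⟩ := (hrun.isGreatest hc k).1
  rw [hi]
  exact ⟨pow_nonneg p.σ_mem.1.le i, pow_le_one₀ p.σ_mem.1.le p.σ_mem.2.le⟩

lemma mem_feasible (k : ℕ) : T.u k ∈ P.feasible := by
  induction k with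
  | zero => exact hrun.init
  | succ k ih =>
    rw [hrun.step]
    exact Problem.segment_mem_feasible ih (hrun.ut_mem_feasible hc k) (hrun.t_mem_Icc hc k)

lemma inner_le (k : ℕ) :
    inner ℝ (gradient P.obj (T.u k)) (T.d p k) ≤ -sqNorm (T.Hu k) (T.d p k) := by
  by_cases h : T.Accepted p k
  · simpa only [d, ut, h, if_true, Hu] using
      (hrun.solvesSplit hc k).inner_le (hrun.mem_feasible hc k)
  · simpa only [d, ut, h, if_false, Hu] using (hrun.joint k h).inner_le (hrun.mem_feasible hc k)

/-- Joint steps have no residual; for split steps the acceptance test applies, and for short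
directions the exponent may be lowered to 2. -/
lemma norm_stationary_le (hτ : 2 ≤ p.τ₁) (k : ℕ) (hd : ‖T.d p k‖ ≤ 1) :
    ‖gradient P.obj (T.u k) + Matrix.toEuclideanCLM (𝕜 := ℝ) (T.Hu k) (T.d p k)
      + ∑ i, (T.multiplier p k).toVec i • P.normal i‖
      ≤ P.couplingConst * p.M₁ * ‖T.d p k‖ ^ 2 := by
  have hC : 0 ≤ P.couplingConst := P.couplingConst_nonneg
  by_cases h : T.Accepted p k
  · have h1 := (hrun.solvesSplit hc k).norm_stationary_le
    have hdk : T.d p k = T.us k - T.u k := by simp only [d, ut, h, if_true]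
    rw [hdk] at hd ⊢
    simp only [multiplier, h, if_true]
    refine h1.trans ?_
    rw [mul_assoc]
    refine mul_le_mul_of_nonneg_left (h.2.trans (mul_le_mul_of_nonneg_left ?_ p.M₁_pos.le)) hC
    rw [← Real.rpow_natCast]
    exact Real.rpow_le_rpow_of_exponent_ge' (norm_nonneg _) hd (by norm_num) (by exact_mod_cast hτ)
  · have h1 := (hrun.joint k h).stationary
    have hdk : T.d p k = T.uj k - T.u k := by simp only [d, ut, h, if_false]
    rw [hdk]
    simp only [multiplier, h, if_false]
    refine le_trans (le_of_eq (norm_eq_zero.2 h1)) ?_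
    have := p.M₁_pos.le
    positivity

end IsRun

lemma active_of_mem_Splus {P : Problem n₁ n₂ m l₁ l₂} {p : Params} (hc : p.c = 1) (k : ℕ)
    {i : Fin m} (hi : i ∈ T.Splus P p k) :
    inner ℝ (P.normal (.inl i)) (T.ut p k) = P.bound (.inl i) := by
  rw [P.active_inl]
  by_cases h : T.Accepted p k
  · simp only [Splus, h, if_true, hc, Finset.mem_filter] at hi
    simp only [ut, h, if_true]
    rw [P.h_add_h (xp (T.u k)) _ (yp (T.u k))]
    linarith [hi.2.1, hi.2.2]
  · simp only [Splus, h, if_false, Problem.activeS, Finset.mem_filter] at hi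
    simpa only [ut, h, if_false] using hi.2

/-- The one-sided constraints that correspond to the rows of `B_k`. -/
def activeIdx (T : Trace n₁ n₂ m l₁ l₂) (P : Problem n₁ n₂ m l₁ l₂) (p : Params) (k : ℕ) :
    Set (Idx m l₁ l₂) :=
  {i | inner ℝ (P.normal i) (T.ut p k) = P.bound i ∧ ∀ j, i = .inl j → j ∈ T.Splus P p k}

/-- Each row of `B_k` is, up to sign, a normal from `activeIdx`, so the projection is invisible to
the vectors on which the abstract theorem tests the error. -/
lemma inner_hessErr_eq {P : Problem n₁ n₂ m l₁ l₂} {p : Params} (hc : p.c = 1) (k : ℕ) (z : Pair n₁ n₂)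
    (hz : ∀ i ∈ T.activeIdx P p k, inner ℝ (P.normal i) z = 0) :
    inner ℝ (Matrix.toEuclideanCLM (𝕜 := ℝ) (T.Pk P p k) (T.hessErr P p k)) z =
      inner ℝ (T.hessErr P p k) z := by
  refine P.inner_projMatrix _ _ _ _ z ((P.rowMatrix_mulVec_eq_zero_iff _ _ _ z).2
    ⟨fun i hi => ?_, fun i hi => ?_, fun i hi => ?_⟩)
  · exact hz (.inl i) ⟨active_of_mem_Splus hc k hi, fun j hj => Sum.inl.inj hj ▸ hi⟩
  · rcases Finset.mem_union.1 hi with hi | hi <;> have h1 := (Finset.mem_filter.1 hi).2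
    · have h3 := hz (.inr (.inl (.inl i))) ⟨(P.active_lx i _).2 h1, by simp⟩
      simpa [Problem.normal, lowerNormal_of_eq h1] using h3
    · have h3 := hz (.inr (.inl (.inr i))) ⟨(P.active_vx i _).2 h1, by simp⟩
      simpa [Problem.normal, upperNormal_of_eq h1] using h3
  · rcases Finset.mem_union.1 hi with hi | hi <;> have h1 := (Finset.mem_filter.1 hi).2
    · have h3 := hz (.inr (.inr (.inl i))) ⟨(P.active_sy i _).2 h1, by simp⟩
      simpa [Problem.normal, lowerNormal_of_eq h1] using h3
    · have h3 := hz (.inr (.inr (.inr i))) ⟨(P.active_ry i _).2 h1, by simp⟩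
      simpa [Problem.normal, upperNormal_of_eq h1] using h3

/-- The error of the second-order approximation is of second order on the null space of suitable
active constraints, which have positive multipliers. -/
lemma exists_hessErr_bound {P : Problem n₁ n₂ m l₁ l₂} {p : Params} (hc : p.c = 1) {ustar : Pair n₁ n₂}
    (happrox :
      (T.hessErr P p =O[atTop] fun k => ‖T.d p k‖ ^ 2) ∨
      (((fun k => Matrix.toEuclideanCLM (𝕜 := ℝ) (T.Pk P p k) (T.hessErr P p k))
          =O[atTop] fun k => ‖T.d p k‖ ^ 2) ∧
        ∀ Λ : Mult m l₁ l₂, P.IsKKT ustar Λ → P.StrictCompl ustar Λ)) :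
    ∃ (A : ℕ → Set (Idx m l₁ l₂)) (B : Set (Idx m l₁ l₂)) (K : ℝ), 0 ≤ K ∧
      (∀ k, ∀ i ∈ A k, i ∈ B ∧ inner ℝ (P.normal i) (T.u k + T.d p k) = P.bound i) ∧
      (∀ᶠ k in atTop, ∀ z, (∀ i ∈ A k, inner ℝ (P.normal i) z = 0) →
        |inner ℝ (T.hessErr P p k) z| ≤ K * ‖T.d p k‖ ^ 2 * ‖z‖) ∧
      ∀ ν, IsMultiplier P.normal P.bound ustar ν →
        gradient P.obj ustar + ∑ i, ν i • P.normal i = 0 →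
        ∀ i ∈ B, inner ℝ (P.normal i) ustar = P.bound i → 0 < ν i := by
  rcases happrox with h | ⟨h, hsc⟩
  · obtain ⟨K, hK, hb⟩ := h.exists_nonneg
    -- With a bound on the full error no constraints have to be singled out, and positivity of
    -- multipliers is required of none.
    refine ⟨fun _ => ∅, ∅, K, hK, by simp, ?_, by simp⟩
    filter_upwards [hb.bound] with k hk z _
    rw [Real.norm_of_nonneg (sq_nonneg _)] at hk
    exact (abs_real_inner_le_norm _ _).trans (mul_le_mul_of_nonneg_right hk (norm_nonneg z))
  · obtain ⟨K, hK, hb⟩ := h.exists_nonneg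
    refine ⟨T.activeIdx P p, Set.univ, K, hK,
      fun k i hi => ⟨Set.mem_univ i, by rw [u_add_d]; exact hi.1⟩, ?_, fun ν hν hstat i _ hi =>
      Problem.strictCompl_ofVec (hsc _ (P.isKKT_ofVec hν hstat)) i hi⟩
    filter_upwards [hb.bound] with k hk z hz
    rw [Real.norm_of_nonneg (sq_nonneg _)] at hk
    rw [← inner_hessErr_eq hc k z hz]
    exact (abs_real_inner_le_norm _ _).trans (mul_le_mul_of_nonneg_right hk (norm_nonneg z))

end Trace

lemma sqNorm_eq_inner {ι : Type} [Fintype ι] [DecidableEq ι] (H : Matrix ι ι ℝ) (z : Vec ι) :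
    sqNorm H z = inner ℝ z (Matrix.toEuclideanCLM (𝕜 := ℝ) H z) := by
  rw [inner_vec, Matrix.ofLp_toEuclideanCLM]; rfl

lemma le_sqNorm_of_posSemidef {ι : Type} [Fintype ι] [DecidableEq ι] {H : Matrix ι ι ℝ} {η : ℝ}
    (h : (H - η • (1 : Matrix ι ι ℝ)).PosSemidef) (z : Vec ι) : η * ‖z‖ ^ 2 ≤ sqNorm H z := by
  have h1 := h.dotProduct_mulVec_nonneg z.ofLp
  rw [star_trivial, Matrix.sub_mulVec, Matrix.smul_mulVec, Matrix.one_mulVec, dotProduct_sub,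
    dotProduct_smul, smul_eq_mul, ← inner_vec z z, real_inner_self_eq_norm_sq] at h1
  rw [sqNorm]; linarith

end CFDSQO

end

theorem theorem7 {n₁ n₂ m l₁ l₂ : ℕ} (P : CFDSQO.Problem n₁ n₂ m l₁ l₂) (p : CFDSQO.Params)
    (T : CFDSQO.Trace n₁ n₂ m l₁ l₂) (ustar : CFDSQO.Pair n₁ n₂)
    (hc : p.c = 1) (hρ : p.ρ < 1 / 2) (hτ : 2 ≤ p.τ₁)
    (hrun : T.IsRun P p)
    (hH : T.MatrixAssumption)
    (hC3 : P.CThreeNearFeasible)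
    (hbdd : Bornology.IsBounded (Set.range T.u))
    (hacc : MapClusterPt ustar atTop T.u)
    (hLICQ : P.LICQ ustar)
    (hSSOS : ∀ Λ : CFDSQO.Mult m l₁ l₂, P.IsKKT ustar Λ → P.SSOS ustar Λ)
    (happrox :
      (T.hessErr P p =O[atTop] fun k => ‖T.d p k‖ ^ 2) ∨
      (((fun k => Matrix.toEuclideanCLM (𝕜 := ℝ) (T.Pk P p k) (T.hessErr P p k))
          =O[atTop] fun k => ‖T.d p k‖ ^ 2) ∧
        ∀ Λ : CFDSQO.Mult m l₁ l₂, P.IsKKT ustar Λ → P.StrictCompl ustar Λ)) :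
    Tendsto T.u atTop (𝓝 ustar) ∧
      (fun k => T.u (k + 1) - ustar) =O[atTop] fun k => ‖T.u k - ustar‖ ^ 2 := by
  obtain ⟨⟨η, hη, hpsd⟩, hbound⟩ := hH
  -- All iterates are bounded, so one bound serves all matrices.
  obtain ⟨R, hR⟩ := hbound Set.univ (by rwa [Set.image_univ])
  obtain ⟨e, he⟩ := hLICQ.exists_dual
  obtain ⟨A, B, K, hK, hA, hE, hSC⟩ := CFDSQO.Trace.exists_hessErr_bound hc happrox
  have hM := mul_nonneg P.couplingConst_nonneg p.M₁_pos.le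
  refine PolyhedralSQP.quadratic_convergence P.contDiff_obj
    (fun hu => hC3.contDiffAt ((P.mem_feasible_iff _).2 hu)) p.ρ_mem.1 hρ p.σ_mem hη hM hK
    (fun k => ?_) (fun k => hR k (Set.mem_univ k)) (fun k => ?_) (fun k => ?_) hrun.step hbdd
    (fun k => (P.mem_feasible_iff _).1 (hrun.mem_feasible hc k)) (hrun.isMultiplier hc)
    (hrun.norm_stationary_le hc hτ) hacc he
    (fun ν hν hstat => CFDSQO.Problem.ssos_ofVec (hSSOS _ (P.isKKT_ofVec hν hstat))) hA hE hSC
  · rw [← CFDSQO.sqNorm_eq_inner]; exact CFDSQO.le_sqNorm_of_posSemidef (hpsd k) _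
  · rw [← CFDSQO.sqNorm_eq_inner]; exact hrun.inner_le hc k
  · rw [← CFDSQO.sqNorm_eq_inner]; exact hrun.isGreatest hc k
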